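/- Let $\Lambda$ and $\Omega$ be (possibly unbounded) self-adjoint operators on a complex Hilbert space $X$, with domains $D(\Lambda)$, $D(\Omega)$, and suppose that $\Lambda$ is non-negative with zero nullspace. Let $\Lambda^2$ have its natural domain $D(\Lambda^2)=\{f\in D(\Lambda):\Lambda f\in D(\Lambda)\}$, and assume that for some $r>0$ the resolvent $(\Lambda^2+r)^{-1}$ maps $D(\Omega)$ into $D(\Omega)$ (so that commutators of $\Omega$ with functions of $\Lambda^2$ make sense). Suppose that there is a constant $c$ such that $$\|[\Omega,\Lambda^2]f\|\le c\,\|\Lambda f\|\qquad\text{for all } f\in D(\Omega)\cap D(\Lambda^2),$$ where $[\Omega,\Lambda^2]f$ is understood in the weak sense: for every such $f$ there is a vector $h=[\Omega,\Lambda^2]f\in X$ with $\|h\|\le c\|\Lambda f\|$ and $\langle g,h\rangle=\langle\Omega g,\Lambda^2 f\rangle-\langle\Lambda^2 g,\Omega f\rangle$ for all $g\in D(\Omega)\cap D(\Lambda^2)$. Then $[\Omega,\Lambda]$ is bounded on $X$: the operator $\Omega\Lambda-\Lambda\Omega$, on its natural domain $\{f\in D(\Lambda)\cap D(\Omega):\Lambda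 f\in D(\Omega),\ \Omega f\in D(\Lambda)\}$, is densely defined and is the restriction of a bounded operator $T$ on $X$. Moreover $\langle g,Tf\rangle=\langle\Omega g,\Lambda f\rangle-\langle\Lambda g,\Omega f\rangle$ for all $f,g\in D(\Omega)\cap D(\Lambda)$. -/

import Mathlib

open scoped InnerProductSpace

noncomputable section

namespace UnboundedOp

variable {X : Type*} [NormedAddCommGroup X] [InnerProductSpace ℂ X]

/-- The natural domain `{f ∈ D(B) : B f ∈ D(A)}` of the product `A B` of two unbounded
operators. -/
def mulDomain (A B : X →ₗ.[ℂ] X) : Submodule ℂ X :=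
  (A.domain.comap B.toFun).map B.domain.subtype

theorem mem_mulDomain {A B : X →ₗ.[ℂ] X} {f : X} :
    f ∈ mulDomain A B ↔ ∃ h : f ∈ B.domain, B ⟨f, h⟩ ∈ A.domain := by
  unfold mulDomain
  constructor
  · rintro ⟨⟨g, hg⟩, h1, rfl⟩
    exact ⟨hg, h1⟩
  · rintro ⟨h, h1⟩
    exact ⟨⟨f, h⟩, h1, rfl⟩

/-- The product `A B` of two unbounded operators, `f ↦ A (B f)` on its natural domain. -/
def mul (A B : X →ₗ.[ℂ] X) : X →ₗ.[ℂ] X :=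
  A.comp (B.domRestrict (mulDomain A B)) (by
    rintro ⟨f, hf⟩
    obtain ⟨h, h1⟩ := mem_mulDomain.1 hf.1
    exact h1)

theorem mem_mul_domain {A B : X →ₗ.[ℂ] X} {f : X} :
    f ∈ (mul A B).domain ↔ ∃ h : f ∈ B.domain, B ⟨f, h⟩ ∈ A.domain := by
  rw [← mem_mulDomain]
  exact ⟨fun h => h.1, fun h => ⟨h, (mem_mulDomain.1 h).1⟩⟩

theorem mul_apply {A B : X →ₗ.[ℂ] X} (f : (mul A B).domain) (h : (f : X) ∈ B.domain)
    (h1 : B ⟨f, h⟩ ∈ A.domain) : mul A B f = A ⟨B ⟨f, h⟩, h1⟩ := rfl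

/-- The commutator `[A, B] = A B - B A` on its natural domain `D(A B) ∩ D(B A)`. -/
def commutator (A B : X →ₗ.[ℂ] X) : X →ₗ.[ℂ] X := mul A B - mul B A

/-- For symmetric operators `A`, `B` and `f ∈ D(A) ∩ D(B)`: the vector `h` is `[A, B] f` in the
weak (sesquilinear form) sense, that is
`⟪g, h⟫ = ⟪A g, B f⟫ - ⟪B g, A f⟫` for all `g ∈ D(A) ∩ D(B)`. -/
def IsWeakCommutatorAt (A B : X →ₗ.[ℂ] X) (f h : X) : Prop :=
  ∃ (hA : f ∈ A.domain) (hB : f ∈ B.domain),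
    ∀ (g : X) (gA : g ∈ A.domain) (gB : g ∈ B.domain),
      ⟪g, h⟫_ℂ = ⟪A ⟨g, gA⟩, B ⟨f, hB⟩⟫_ℂ - ⟪B ⟨g, gB⟩, A ⟨f, hA⟩⟫_ℂ

end UnboundedOp

end

/-! Formally, if C = [Ω, Λ], then ΛC + CΛ = [Ω, Λ²], a Sylvester equation whose right side N
satisfies ‖Nf‖ ≤ c‖Λf‖. For a bounded coercive symmetric B in place of Λ it is solved by positivity,
used twice. Let M = ±iC, which is symmetric, and P = cB - (BM + MB). The bound ‖(BM + MB)f‖ ≤ c‖Bf‖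
gives BP + PB ≥ 0, hence P ≥ 0. But P = BQ + QB with Q = c/2 - M, hence Q ≥ 0. So the form of iC
lies between -c/2 and c/2 (`nonneg_of_lyapunov`, `norm_apply_le_of_sylvester`).

For B one takes the square root of s(Λ² + s⁻¹)(Λ² + s)⁻¹. Its square is affine in the resolvent, so
the hypothesis on [Ω, Λ²] yields ‖[Ω, B²]f‖ ≤ c‖Bf‖ with c independent of s
(`HasRelBoundedSqComm.commBound_sqrt`). That B has some bounded commutator with Ω at all, needed
before the algebra makes sense, holds because B is a limit of a contractive iteration preserving a
commutator bound (`IsSqResolvent.exists_sqrt`).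

As s → ∞, B converges weakly to Λ on D(Λ²) (`tendsto_inner_sqrt`), so the form of [Ω, Λ] is bounded
there. Regularizing with s(Λ² + s)⁻¹ extends the bound to D(Ω) ∩ D(Λ), and also supplies the dense
domain of the operator commutator. -/

namespace UnboundedOp

open Filter Topology ContinuousLinearMap

/-! ### Self-adjoint graphs and the resolvents of the square -/

/-- A linear relation (the graph of an operator) that equals its adjoint. -/
def IsSelfAdjointRelation {X : Type*} [NormedAddCommGroup X] [InnerProductSpace ℂ X]
    (G : Submodule ℂ (X × X)) : Prop :=
  ∀ x y, (x, y) ∈ G ↔ ∀ a b, (a, b) ∈ G → ⟪b, x⟫_ℂ = ⟪a, y⟫_ℂ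

/-- `R = (L² + s)⁻¹` and `V = L R`, where `G` is the graph of `L`. -/
structure IsSqResolvent {X : Type*} [NormedAddCommGroup X] [InnerProductSpace ℂ X]
    (G : Submodule ℂ (X × X)) (s : ℝ) (R V : X →L[ℂ] X) : Prop where
  mem : ∀ x, (R x, V x) ∈ G
  mem' : ∀ x, (V x, x - (s : ℂ) • R x) ∈ G

section Relation

variable {X : Type*} [NormedAddCommGroup X] [InnerProductSpace ℂ X] {G : Submodule ℂ (X × X)}

theorem mem_smul_pair {x y : X} (h : (x, y) ∈ G) (a : ℂ) : (a • x, a • y) ∈ G :=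
  G.smul_mem a h

theorem mem_add_pair {x y x' y' : X} (h : (x, y) ∈ G) (h' : (x', y') ∈ G) :
    (x + x', y + y') ∈ G := G.add_mem h h'

theorem mem_sub_pair {x y x' y' : X} (h : (x, y) ∈ G) (h' : (x', y') ∈ G) :
    (x - x', y - y') ∈ G := G.sub_mem h h'

theorem IsSelfAdjointRelation.inner_eq (hG : IsSelfAdjointRelation G) {x y a b : X}
    (h : (x, y) ∈ G) (h' : (a, b) ∈ G) : ⟪b, x⟫_ℂ = ⟪a, y⟫_ℂ := (hG x y).1 h a b h'

theorem IsSelfAdjointRelation.isClosed (hG : IsSelfAdjointRelation G) :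
    IsClosed (G : Set (X × X)) := by
  have : (G : Set (X × X)) = ⋂ (a : X) (b : X) (_ : (a, b) ∈ G),
      {p : X × X | ⟪b, p.1⟫_ℂ = ⟪a, p.2⟫_ℂ} := by
    ext ⟨x, y⟩
    simp only [SetLike.mem_coe, Set.mem_iInter, Set.mem_ofPred_eq]
    exact hG x y
  rw [this]
  exact isClosed_iInter fun a => isClosed_iInter fun b => isClosed_iInter fun _ =>
    isClosed_eq (by fun_prop) (by fun_prop)

theorem IsSelfAdjointRelation.mem_of_tendsto (hG : IsSelfAdjointRelation G) {ι : Type*}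
    {l : Filter ι} [l.NeBot] {u v : ι → X} {x y : X} (hu : Tendsto u l (𝓝 x))
    (hv : Tendsto v l (𝓝 y)) (h : ∀ᶠ i in l, (u i, v i) ∈ G) : (x, y) ∈ G :=
  hG.isClosed.mem_of_tendsto (hu.prodMk_nhds hv) h

theorem IsSelfAdjointRelation.norm_sq_add (hG : IsSelfAdjointRelation G) {u v w : X}
    (h : (u, v) ∈ G) (h' : (v, w) ∈ G) (s : ℝ) :
    ‖w + (s : ℂ) • u‖ ^ 2 = ‖w‖ ^ 2 + 2 * s * ‖v‖ ^ 2 + s ^ 2 * ‖u‖ ^ 2 := by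
  have h1 : ⟪w, u⟫_ℂ = ⟪v, v⟫_ℂ := hG.inner_eq h h'
  have h2 := norm_add_sq (𝕜 := ℂ) w ((s : ℂ) • u)
  rw [inner_smul_right, h1, inner_self_eq_norm_sq_to_K, norm_smul] at h2
  rw [h2]
  have : RCLike.re ((s : ℂ) * (((‖v‖ : ℝ) : ℂ)) ^ 2) = s * ‖v‖ ^ 2 := by
    rw [← Complex.ofReal_pow, ← Complex.ofReal_mul]; exact Complex.ofReal_re _
  erw [this]
  rw [Complex.norm_real, mul_pow, Real.norm_eq_abs, sq_abs]
  ring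

theorem IsSelfAdjointRelation.norm_le_of_sq_add (hG : IsSelfAdjointRelation G) {u v w x : X}
    (h : (u, v) ∈ G) (h' : (v, w) ∈ G) {s : ℝ} (hs : 0 < s) (hx : w + (s : ℂ) • u = x) :
    s * ‖u‖ ≤ ‖x‖ ∧ √s * ‖v‖ ≤ ‖x‖ ∧ ‖w‖ ≤ ‖x‖ := by
  have h1 := hG.norm_sq_add h h' s
  rw [hx] at h1
  have h2 : 0 ≤ s * ‖v‖ ^ 2 := by positivity
  have h3 : 0 ≤ (s * ‖u‖) ^ 2 := by positivity
  have h4 : 0 ≤ ‖w‖ ^ 2 := by positivity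
  refine ⟨?_, ?_, ?_⟩ <;> refine le_of_sq_le_sq ?_ (norm_nonneg _)
  · nlinarith
  · rw [mul_pow, Real.sq_sqrt hs.le]; nlinarith
  · nlinarith

theorem IsSelfAdjointRelation.eq_of_sq_add (hG : IsSelfAdjointRelation G) {u v w u' v' w' : X}
    (h : (u, v) ∈ G) (h' : (v, w) ∈ G) (k : (u', v') ∈ G) (k' : (v', w') ∈ G) {s : ℝ}
    (hs : 0 < s) (hx : w + (s : ℂ) • u = w' + (s : ℂ) • u') : u = u' ∧ v = v' := by
  obtain ⟨h1, h2, -⟩ := hG.norm_le_of_sq_add (mem_sub_pair h k) (mem_sub_pair h' k') hs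
    (x := 0) (by rw [smul_sub, sub_add_sub_comm, hx, sub_self])
  rw [norm_zero] at h1 h2
  constructor
  · refine sub_eq_zero.1 (norm_le_zero_iff.1 ?_)
    exact le_of_mul_le_mul_left (by simpa using h1) hs
  · refine sub_eq_zero.1 (norm_le_zero_iff.1 ?_)
    exact le_of_mul_le_mul_left (by simpa using h2) (Real.sqrt_pos.2 hs)

/-- Von Neumann's argument: the orthogonal complement of a self-adjoint graph is the rotated graph,
so splitting a vector (·, 0) along the two solves the equation. -/
theorem IsSelfAdjointRelation.exists_sq_add [CompleteSpace X] (hG : IsSelfAdjointRelation G)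
    {s : ℝ} (hs : 0 < s) (x : X) :
    ∃ u v w, (u, v) ∈ G ∧ (v, w) ∈ G ∧ w + (s : ℂ) • u = x := by
  obtain ⟨σ, hσ, rfl⟩ : ∃ σ : ℝ, 0 < σ ∧ s = σ ^ 2 :=
    ⟨√s, Real.sqrt_pos.2 hs, (Real.sq_sqrt hs.le).symm⟩
  have hσ0 : (σ : ℂ) ≠ 0 := by exact_mod_cast hσ.ne'
  -- `K` consists of the pairs (σa, b) with (a, b) in `G`; the weight σ turns L² + 1 into L² + σ².
  let K : Submodule ℂ (WithLp 2 (X × X)) :=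
    G.comap ((((σ : ℂ)⁻¹ • LinearMap.id).prodMap LinearMap.id : X × X →ₗ[ℂ] X × X) ∘ₗ
      (WithLp.linearEquiv 2 ℂ (X × X)).toLinearMap)
  have hK : ∀ p, p ∈ K ↔ ((σ : ℂ)⁻¹ • p.fst, p.snd) ∈ G := fun p => Iff.rfl
  have hKc : IsClosed (K : Set (WithLp 2 (X × X))) := by
    have : Continuous fun p : WithLp 2 (X × X) => ((σ : ℂ)⁻¹ • p.fst, p.snd) := by fun_prop
    exact hG.isClosed.preimage this
  have : CompleteSpace K := hKc.completeSpace_coe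
  obtain ⟨p, hp, q, hq, hpq⟩ := K.exists_add_mem_mem_orthogonal
    (WithLp.toLp 2 ((σ : ℂ)⁻¹ • x, 0))
  have e1 : (σ : ℂ)⁻¹ • x = p.fst + q.fst := congrArg (fun z => z.fst) hpq
  have e2 : (0 : X) = p.snd + q.snd := congrArg (fun z => z.snd) hpq
  have hq' : (q.snd, -(σ : ℂ) • q.fst) ∈ G := by
    rw [hG]
    intro a b hab
    have := (Submodule.mem_orthogonal _ _).1 hq (WithLp.toLp 2 ((σ : ℂ) • a, b)) (by
      rw [hK]
      change ((σ : ℂ)⁻¹ • (σ : ℂ) • a, b) ∈ G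
      rwa [smul_smul, inv_mul_cancel₀ hσ0, one_smul])
    rw [WithLp.prod_inner_apply] at this
    change ⟪(σ : ℂ) • a, q.fst⟫_ℂ + ⟪b, q.snd⟫_ℂ = 0 at this
    rw [inner_smul_left, Complex.conj_ofReal] at this
    rw [inner_smul_right]
    linear_combination this
  rw [hK] at hp
  refine ⟨(σ : ℂ)⁻¹ • p.fst, p.snd, (σ : ℂ) • q.fst, hp, ?_, ?_⟩
  · have := mem_smul_pair hq' (-1)
    rw [eq_neg_of_add_eq_zero_left e2.symm]
    simpa using this
  · rw [smul_smul]
    have : ((σ ^ 2 : ℝ) : ℂ) * (σ : ℂ)⁻¹ = σ := by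
      push_cast; field_simp
    rw [this, ← smul_add, add_comm, ← e1, smul_smul, mul_inv_cancel₀ hσ0, one_smul]

theorem IsSelfAdjointRelation.exists_isSqResolvent [CompleteSpace X]
    (hG : IsSelfAdjointRelation G) {s : ℝ} (hs : 0 < s) : ∃ R V, IsSqResolvent G s R V := by
  choose u v w h h' hx using hG.exists_sq_add hs
  have hadd : ∀ x y, u (x + y) = u x + u y ∧ v (x + y) = v x + v y := fun x y =>
    hG.eq_of_sq_add (h _) (h' _) (mem_add_pair (h x) (h y)) (mem_add_pair (h' x) (h' y)) hs
      (by rw [hx, smul_add, add_add_add_comm, hx, hx])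
  have hsmul : ∀ (a : ℂ) x, u (a • x) = a • u x ∧ v (a • x) = a • v x := fun a x =>
    hG.eq_of_sq_add (h _) (h' _) (mem_smul_pair (h x) a) (mem_smul_pair (h' x) a) hs
      (by rw [hx, smul_comm, ← smul_add, hx])
  let R : X →L[ℂ] X := LinearMap.mkContinuous
    { toFun := u, map_add' := fun x y => (hadd x y).1, map_smul' := fun a x => (hsmul a x).1 }
    s⁻¹ (fun x => by
      have := (hG.norm_le_of_sq_add (h x) (h' x) hs (hx x)).1
      rw [inv_mul_eq_div, le_div_iff₀' hs]
      exact this)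
  let V : X →L[ℂ] X := LinearMap.mkContinuous
    { toFun := v, map_add' := fun x y => (hadd x y).2, map_smul' := fun a x => (hsmul a x).2 }
    (√s)⁻¹ (fun x => by
      have := (hG.norm_le_of_sq_add (h x) (h' x) hs (hx x)).2.1
      rw [inv_mul_eq_div, le_div_iff₀' (Real.sqrt_pos.2 hs)]
      exact this)
  refine ⟨R, V, h, fun x => ?_⟩
  have : w x = x - (s : ℂ) • R x := eq_sub_of_add_eq (hx x)
  rw [← this]
  exact h' x

namespace IsSqResolvent

variable {s : ℝ} {R V : X →L[ℂ] X}

theorem eq_of_mem (h : IsSqResolvent G s R V) (hG : IsSelfAdjointRelation G) (hs : 0 < s)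
    {u v w x : X} (hu : (u, v) ∈ G) (hv : (v, w) ∈ G) (hx : w + (s : ℂ) • u = x) :
    R x = u ∧ V x = v :=
  hG.eq_of_sq_add (h.mem x) (h.mem' x) hu hv hs (by rw [sub_add_cancel, hx])

theorem norm_le (h : IsSqResolvent G s R V) (hG : IsSelfAdjointRelation G) (hs : 0 < s) (x : X) :
    s * ‖R x‖ ≤ ‖x‖ ∧ √s * ‖V x‖ ≤ ‖x‖ ∧ ‖x - (s : ℂ) • R x‖ ≤ ‖x‖ :=
  hG.norm_le_of_sq_add (h.mem x) (h.mem' x) hs (sub_add_cancel _ _)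

theorem apply_of_mem (h : IsSqResolvent G s R V) (hG : IsSelfAdjointRelation G) (hs : 0 < s)
    {f f' : X} (hf : (f, f') ∈ G) : R f' = V f ∧ V f' = f - (s : ℂ) • R f :=
  h.eq_of_mem hG hs (h.mem' f) (mem_sub_pair hf (mem_smul_pair (h.mem f) s)) (sub_add_cancel _ _)

theorem map_mem (h : IsSqResolvent G s R V) (hG : IsSelfAdjointRelation G) (hs : 0 < s)
    {f f' : X} (hf : (f, f') ∈ G) : (R f, R f') ∈ G := by
  rw [(h.apply_of_mem hG hs hf).1]
  exact h.mem f

theorem inner_apply (h : IsSqResolvent G s R V) (hG : IsSelfAdjointRelation G) (x y : X) :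
    ⟪R x, y⟫_ℂ = ⟪V x, V y⟫_ℂ + s * ⟪R x, R y⟫_ℂ := by
  have := hG.inner_eq (h.mem' y) (h.mem x)
  rw [this, inner_sub_right, inner_smul_right]
  ring

theorem inner_left (h : IsSqResolvent G s R V) (hG : IsSelfAdjointRelation G) (x y : X) :
    ⟪R x, y⟫_ℂ = ⟪x, R y⟫_ℂ := by
  rw [h.inner_apply hG x y, ← inner_conj_symm x, h.inner_apply hG y x]
  simp [inner_conj_symm]

theorem norm_sub_le (h : IsSqResolvent G s R V) (hG : IsSelfAdjointRelation G) (hs : 0 < s)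
    {f f' : X} (hf : (f, f') ∈ G) : √s * ‖f - (s : ℂ) • R f‖ ≤ ‖f'‖ := by
  rw [← (h.apply_of_mem hG hs hf).2]
  exact (h.norm_le hG hs f').2.1

end IsSqResolvent

/-- On the domain the error is O(1/√s); the maps 1 - s(L² + s)⁻¹ are contractions, so density gives
the rest. -/
theorem tendsto_smul_sqResolvent {R V : ℝ → X →L[ℂ] X} (hG : IsSelfAdjointRelation G)
    (hd : Dense {f : X | ∃ f', (f, f') ∈ G})
    (h : ∀ s > 0, IsSqResolvent G s (R s) (V s)) (f : X) :
    Tendsto (fun s : ℝ => (s : ℂ) • R s f) atTop (𝓝 f) := by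
  rw [Metric.tendsto_nhds]
  intro ε hε
  obtain ⟨g, ⟨g', hg⟩, hgf⟩ := Metric.mem_closure_iff.1 (hd f) (ε / 4) (by positivity)
  have h0 : Tendsto (fun s : ℝ => ‖g'‖ / √s) atTop (𝓝 0) :=
    tendsto_const_nhds.div_atTop Real.tendsto_sqrt_atTop
  filter_upwards [h0.eventually (gt_mem_nhds (show (0 : ℝ) < ε / 4 by positivity)),
    eventually_gt_atTop 0] with s hs1 hs
  have e1 : ‖g - (s : ℂ) • R s g‖ ≤ ‖g'‖ / √s := by
    rw [le_div_iff₀' (Real.sqrt_pos.2 hs)]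
    exact (h s hs).norm_sub_le hG hs hg
  have e2 := ((h s hs).norm_le hG hs (f - g)).2.2
  rw [dist_eq_norm] at hgf
  rw [dist_comm, dist_eq_norm]
  have e3 : f - (s : ℂ) • R s f = (f - g - (s : ℂ) • R s (f - g)) + (g - (s : ℂ) • R s g) := by
    rw [map_sub, smul_sub]; abel
  rw [e3]
  refine (norm_add_le _ _).trans_lt ?_
  linarith

end Relation
-- Fixed points in closed sets; bounded operators from densely defined relations and forms
theorem exists_fixedPoint_mem {E : Type*} [NormedAddCommGroup E] [CompleteSpace E] {S : Set E}
    (hS : IsClosed S) {F : E → E} (hFS : ∀ x ∈ S, F x ∈ S) {q : ℝ} (hq0 : 0 ≤ q) (hq : q < 1)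
    (hF : ∀ x ∈ S, ∀ y ∈ S, ‖F x - F y‖ ≤ q * ‖x - y‖) {x₀ : E} (hx₀ : x₀ ∈ S) :
    ∃ x ∈ S, F x = x := by
  have hmaps : Set.MapsTo F S S := hFS
  have hc : ContractingWith ⟨q, hq0⟩ (hmaps.restrict F S S) := by
    refine ⟨hq, LipschitzWith.of_dist_le_mul ?_⟩
    rintro ⟨x, hx⟩ ⟨y, hy⟩
    rw [Subtype.dist_eq, Subtype.dist_eq, dist_eq_norm, dist_eq_norm]
    exact hF x hx y hy
  obtain ⟨y, hy, hfix, -⟩ :=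
    hc.exists_fixedPoint' hS.isComplete hmaps hx₀ (edist_ne_top _ _)
  exact ⟨y, hy, hfix⟩

theorem exists_clm_of_bounded_relation {X Y : Type*} [NormedAddCommGroup X] [NormedSpace ℂ X]
    [NormedAddCommGroup Y] [NormedSpace ℂ Y] [CompleteSpace Y] (Γ : Submodule ℂ (X × Y))
    (hd : Dense {f : X | ∃ h, (f, h) ∈ Γ}) {d : ℝ} (hb : ∀ f h, (f, h) ∈ Γ → ‖h‖ ≤ d * ‖f‖) :
    ∃ T : X →L[ℂ] Y, (∀ x, ‖T x‖ ≤ d * ‖x‖) ∧ ∀ f h, (f, h) ∈ Γ → T f = h := by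
  let e : Γ →ₗ[ℂ] X := LinearMap.fst ℂ X Y ∘ₗ Γ.subtype
  let k : Γ →ₗ[ℂ] Y := LinearMap.snd ℂ X Y ∘ₗ Γ.subtype
  have hk : ∀ x : Γ, ‖k x‖ ≤ d * ‖e x‖ := fun x => hb _ _ x.2
  have he : DenseRange e := by
    refine hd.mono ?_
    rintro f ⟨h, hfh⟩
    exact ⟨⟨(f, h), hfh⟩, rfl⟩
  exact ⟨k.extendOfNorm e, LinearMap.norm_extendOfNorm_apply_le he d hk,
    fun f h hfh => LinearMap.extendOfNorm_eq he ⟨d, hk⟩ ⟨(f, h), hfh⟩⟩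

section

variable {X : Type*} [NormedAddCommGroup X] [InnerProductSpace ℂ X]

theorem norm_le_of_dense_inner {P : Set X} (hP : Dense P) {h : X} {M : ℝ} (hM : 0 ≤ M)
    (hb : ∀ g ∈ P, ‖⟪g, h⟫_ℂ‖ ≤ M * ‖g‖) : ‖h‖ ≤ M := by
  have hcl : IsClosed {g : X | ‖⟪g, h⟫_ℂ‖ ≤ M * ‖g‖} :=
    isClosed_le (by fun_prop) (by fun_prop)
  have hh : ‖⟪h, h⟫_ℂ‖ ≤ M * ‖h‖ := (hcl.closure_subset_iff.2 hb) (hP h)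
  rw [inner_self_eq_norm_sq_to_K, norm_pow, RCLike.norm_ofReal, abs_norm] at hh
  by_contra hcon
  push Not at hcon
  nlinarith

/-- A bounded sesquilinear form, given by `⟪g₁, f₂⟫ - ⟪g₂, f₁⟫` for triples `(f, f₁, f₂)` of a
submodule, comes from a bounded operator. -/
theorem exists_clm_of_bounded_form [CompleteSpace X] (Θ : Submodule ℂ (X × X × X))
    (hd : Dense {f : X | ∃ p, (f, p) ∈ Θ}) {d : ℝ} (hd0 : 0 ≤ d)
    (hb : ∀ f f₁ f₂ g g₁ g₂, (f, f₁, f₂) ∈ Θ → (g, g₁, g₂) ∈ Θ →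
      ‖⟪g₁, f₂⟫_ℂ - ⟪g₂, f₁⟫_ℂ‖ ≤ d * ‖f‖ * ‖g‖) :
    ∃ T : X →L[ℂ] X, (∀ x, ‖T x‖ ≤ d * ‖x‖) ∧
      ∀ f f₁ f₂ g g₁ g₂, (f, f₁, f₂) ∈ Θ → (g, g₁, g₂) ∈ Θ →
        ⟪g, T f⟫_ℂ = ⟪g₁, f₂⟫_ℂ - ⟪g₂, f₁⟫_ℂ := by
  have hex : ∀ f f₁ f₂, (f, f₁, f₂) ∈ Θ → ∃ h, ∀ g g₁ g₂, (g, g₁, g₂) ∈ Θ →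
      ⟪g, h⟫_ℂ = ⟪g₁, f₂⟫_ℂ - ⟪g₂, f₁⟫_ℂ := by
    intro f f₁ f₂ hf
    let φ : X × X × X →ₗ[ℂ] X × ℂ := (LinearMap.fst ℂ X (X × X)).prod
      ((innerₛₗ ℂ f₂ ∘ₗ LinearMap.fst ℂ X X - innerₛₗ ℂ f₁ ∘ₗ LinearMap.snd ℂ X X) ∘ₗ
        LinearMap.snd ℂ X (X × X))
    have hφ : ∀ g g₁ g₂, φ (g, g₁, g₂) = (g, ⟪f₂, g₁⟫_ℂ - ⟪f₁, g₂⟫_ℂ) := fun _ _ _ => rfl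
    obtain ⟨T, -, hT⟩ := exists_clm_of_bounded_relation (Θ.map φ) (d := d * ‖f‖)
      (hd.mono (by
        rintro g ⟨⟨g₁, g₂⟩, hg⟩
        exact ⟨_, _, hg, hφ g g₁ g₂⟩))
      (by
        rintro g z ⟨⟨k, g₁, g₂⟩, hg, heq⟩
        rw [hφ, Prod.mk.injEq] at heq
        obtain ⟨rfl, rfl⟩ := heq
        have := hb _ _ _ _ _ _ hf hg
        rw [← Complex.norm_conj] at this
        simpa [inner_conj_symm] using this)
    refine ⟨(InnerProductSpace.toDual ℂ X).symm T, fun g g₁ g₂ hg => ?_⟩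
    rw [← inner_conj_symm, InnerProductSpace.toDual_symm_apply, hT _ _ ⟨_, hg, hφ g g₁ g₂⟩]
    simp [inner_conj_symm]
  let Γ : Submodule ℂ (X × X) :=
    { carrier := {p | ∃ f₁ f₂, (p.1, f₁, f₂) ∈ Θ ∧ ∀ g g₁ g₂, (g, g₁, g₂) ∈ Θ →
        ⟪g, p.2⟫_ℂ = ⟪g₁, f₂⟫_ℂ - ⟪g₂, f₁⟫_ℂ}
      zero_mem' := ⟨0, 0, Θ.zero_mem, by simp⟩
      add_mem' := by
        rintro ⟨f, h⟩ ⟨f', h'⟩ ⟨f₁, f₂, hf, hh⟩ ⟨f₁', f₂', hf', hh'⟩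
        refine ⟨f₁ + f₁', f₂ + f₂', Θ.add_mem hf hf', fun g g₁ g₂ hg => ?_⟩
        have e := hh g g₁ g₂ hg
        have e' := hh' g g₁ g₂ hg
        simp only [Prod.mk_add_mk, inner_add_right] at *
        rw [e, e']; ring
      smul_mem' := by
        rintro a ⟨f, h⟩ ⟨f₁, f₂, hf, hh⟩
        refine ⟨a • f₁, a • f₂, Θ.smul_mem a hf, fun g g₁ g₂ hg => ?_⟩
        have e := hh g g₁ g₂ hg
        simp only [Prod.smul_mk, inner_smul_right] at *
        rw [e]; ring }
  obtain ⟨T, hT, hTΓ⟩ := exists_clm_of_bounded_relation Γ (d := d)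
    (hd.mono (by
      rintro f ⟨⟨f₁, f₂⟩, hf⟩
      obtain ⟨h, hh⟩ := hex f f₁ f₂ hf
      exact ⟨h, f₁, f₂, hf, hh⟩))
    (by
      rintro f h ⟨f₁, f₂, hf, hh⟩
      refine norm_le_of_dense_inner hd (by positivity) ?_
      rintro g ⟨⟨g₁, g₂⟩, hg⟩
      rw [hh g g₁ g₂ hg]
      exact hb _ _ _ _ _ _ hf hg)
  refine ⟨T, hT, fun f f₁ f₂ g g₁ g₂ hf hg => ?_⟩
  obtain ⟨h, hh⟩ := hex f f₁ f₂ hf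
  rw [hTΓ f h ⟨f₁, f₂, hf, hh⟩]
  exact hh g g₁ g₂ hg

/-! ### Bounded commutators with a self-adjoint operator -/

variable {W : Submodule ℂ (X × X)}

/-- The commutator of the self-adjoint operator with graph `W` and the bounded operator `S` is
bounded by `d`, as a sesquilinear form. -/
def CommBound (W : Submodule ℂ (X × X)) (S : X →L[ℂ] X) (d : ℝ) : Prop :=
  ∀ f f' g g', (f, f') ∈ W → (g, g') ∈ W → ‖⟪g', S f⟫_ℂ - ⟪g, S f'⟫_ℂ‖ ≤ d * ‖f‖ * ‖g‖

/-- This closedness lets an operator built as a fixed point inherit a commutator bound from its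
iterates. -/
theorem isClosed_setOf_commBound (W : Submodule ℂ (X × X)) (d : ℝ) :
    IsClosed {S : X →L[ℂ] X | CommBound W S d} := by
  simp only [CommBound, Set.ofPred_forall]
  refine isClosed_iInter fun f => isClosed_iInter fun f' => isClosed_iInter fun g =>
    isClosed_iInter fun g' => isClosed_iInter fun _ => isClosed_iInter fun _ =>
    isClosed_le ?_ continuous_const
  fun_prop

namespace CommBound

variable {S T : X →L[ℂ] X} {d e : ℝ}

theorem mono (h : CommBound W S d) (hde : d ≤ e) : CommBound W S e :=
  fun f f' g g' hf hg => (h f f' g g' hf hg).trans (by gcongr)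

theorem add (hS : CommBound W S d) (hT : CommBound W T e) : CommBound W (S + T) (d + e) := by
  intro f f' g g' hf hg
  have : ⟪g', (S + T) f⟫_ℂ - ⟪g, (S + T) f'⟫_ℂ =
      (⟪g', S f⟫_ℂ - ⟪g, S f'⟫_ℂ) + (⟪g', T f⟫_ℂ - ⟪g, T f'⟫_ℂ) := by
    simp only [add_apply, inner_add_right]; ring
  rw [this]
  refine (norm_add_le _ _).trans ((add_le_add (hS _ _ _ _ hf hg) (hT _ _ _ _ hf hg)).trans ?_)
  apply le_of_eq; ring

theorem smul (hS : CommBound W S d) (a : ℂ) : CommBound W (a • S) (‖a‖ * d) := by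
  intro f f' g g' hf hg
  have : ⟪g', (a • S) f⟫_ℂ - ⟪g, (a • S) f'⟫_ℂ = a * (⟪g', S f⟫_ℂ - ⟪g, S f'⟫_ℂ) := by
    simp only [smul_apply, inner_smul_right]; ring
  rw [this, norm_mul]
  refine (mul_le_mul_of_nonneg_left (hS _ _ _ _ hf hg) (norm_nonneg _)).trans (le_of_eq ?_)
  ring

theorem one (hW : IsSelfAdjointRelation W) : CommBound W (1 : X →L[ℂ] X) 0 := by
  intro f f' g g' hf hg
  simp [hW.inner_eq hf hg]

theorem zero : CommBound W (0 : X →L[ℂ] X) 0 := by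
  intro f f' g g' hf hg
  simp

/-- The bound makes g ↦ ⟪S f, W g⟫ - ⟪S f', g⟫ a bounded functional, so by Riesz S f lies in the
domain of the adjoint, which is that of W. -/
theorem exists_mem [CompleteSpace X] (hW : IsSelfAdjointRelation W)
    (hd : Dense {f : X | ∃ f', (f, f') ∈ W}) (hS : CommBound W S d) {f f' : X}
    (hf : (f, f') ∈ W) : ∃ k, (S f, k) ∈ W := by
  let φ : X × X →ₗ[ℂ] X × ℂ := (LinearMap.fst ℂ X X).prod
    (innerₛₗ ℂ (S f) ∘ₗ LinearMap.snd ℂ X X - innerₛₗ ℂ (S f') ∘ₗ LinearMap.fst ℂ X X)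
  have hφ : ∀ g g', φ (g, g') = (g, ⟪S f, g'⟫_ℂ - ⟪S f', g⟫_ℂ) := fun _ _ => rfl
  obtain ⟨T, -, hT⟩ := exists_clm_of_bounded_relation (W.map φ) (d := d * ‖f‖)
    (hd.mono (by
      rintro g ⟨g', hg⟩
      exact ⟨_, _, hg, hφ g g'⟩))
    (by
      rintro g z ⟨⟨k, g'⟩, hg, heq⟩
      rw [hφ, Prod.mk.injEq] at heq
      obtain ⟨rfl, rfl⟩ := heq
      have := hS _ _ _ _ hf hg
      rw [← Complex.norm_conj] at this
      simpa [inner_conj_symm] using this)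
  refine ⟨S f' + (InnerProductSpace.toDual ℂ X).symm T, (hW _ _).2 fun g g' hg => ?_⟩
  rw [inner_add_right, ← inner_conj_symm g ((InnerProductSpace.toDual ℂ X).symm T),
    InnerProductSpace.toDual_symm_apply, hT _ _ ⟨_, hg, hφ g g'⟩]
  simp [inner_conj_symm]

/-- The Leibniz rule [W, ST] = [W, S]T + S[W, T]; `exists_mem` keeps the intermediate vectors in the
domain of W. -/
theorem mul [CompleteSpace X] (hW : IsSelfAdjointRelation W)
    (hd : Dense {f : X | ∃ f', (f, f') ∈ W}) (hSa : ∀ x y, ⟪S x, y⟫_ℂ = ⟪x, S y⟫_ℂ)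
    (hS : CommBound W S d) (hT : CommBound W T e) (hd0 : 0 ≤ d) (he0 : 0 ≤ e) :
    CommBound W (S * T) (d * ‖T‖ + ‖S‖ * e) := by
  intro f f' g g' hf hg
  obtain ⟨k, hk⟩ := hT.exists_mem hW hd hf
  obtain ⟨l, hl⟩ := hS.exists_mem hW hd hg
  have h1 := hS _ _ _ _ hk hg
  have h2 := hT _ _ _ _ hf hl
  have e1 : ⟪l, T f⟫_ℂ = ⟪S g, k⟫_ℂ := hW.inner_eq hk hl
  have : ⟪g', (S * T) f⟫_ℂ - ⟪g, (S * T) f'⟫_ℂ =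
      (⟪g', S (T f)⟫_ℂ - ⟪g, S k⟫_ℂ) + (⟪l, T f⟫_ℂ - ⟪S g, T f'⟫_ℂ) := by
    rw [e1, hSa, hSa]; simp
  rw [this]
  refine (norm_add_le _ _).trans ((add_le_add h1 h2).trans ?_)
  have h3 := T.le_opNorm f
  have h4 := S.le_opNorm g
  calc d * ‖T f‖ * ‖g‖ + e * ‖f‖ * ‖S g‖
      ≤ d * (‖T‖ * ‖f‖) * ‖g‖ + e * ‖f‖ * (‖S‖ * ‖g‖) := by gcongr
    _ = _ := by ring

end CommBound

/-- If `(L² + r)⁻¹` has a bounded commutator with a self-adjoint operator, then so has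
`(L² + s)⁻¹` for every `s ≥ r`. -/
theorem CommBound.sqResolvent_of_le [CompleteSpace X] {G : Submodule ℂ (X × X)}
    (hG : IsSelfAdjointRelation G) (hW : IsSelfAdjointRelation W)
    (hd : Dense {f : X | ∃ f', (f, f') ∈ W}) {r s : ℝ} (hr : 0 < r) (hrs : r ≤ s)
    {R V R' V' : X →L[ℂ] X} (h : IsSqResolvent G r R V) (h' : IsSqResolvent G s R' V')
    {d : ℝ} (hd0 : 0 ≤ d) (hR : CommBound W R d) : ∃ e, CommBound W R' e := by
  have hs : 0 < s := hr.trans_le hrs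
  set κ := s - r with hκ
  have hκ0 : 0 ≤ κ := sub_nonneg.2 hrs
  have hs0 : (s : ℂ) ≠ 0 := by exact_mod_cast hs.ne'
  have hr0 : (r : ℂ) ≠ 0 := by exact_mod_cast hr.ne'
  have hRn : ‖R‖ ≤ 1 / r := opNorm_le_bound _ (by positivity) fun x => by
    rw [div_mul_eq_mul_div, le_div_iff₀' hr, one_mul]
    exact (h.norm_le hG hr x).1
  -- The resolvent identity R = R' + κ R R' is rewritten as R' = (r/s)(R + Z R') with ‖Z‖ ≤ κ/r. The
  -- right side contracts with ratio κ/s < 1 for every s ≥ r, whereas R' = R - κ R R' is only seen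
  -- to contract for κ < r.
  let Z : X →L[ℂ] X := (κ / r : ℂ) • (1 - (r : ℂ) • R)
  have hZn : ‖Z‖ ≤ κ / r := opNorm_le_bound _ (by positivity) fun x => by
    have := (h.norm_le hG hr x).2.2
    simp only [Z, smul_apply, sub_apply, one_apply_eq_self, norm_smul]
    have hn : ‖(κ / r : ℂ)‖ = κ / r := by
      rw [← Complex.ofReal_div, Complex.norm_real, Real.norm_of_nonneg (by positivity)]
    rw [hn]
    gcongr
  have hZa : ∀ x y, ⟪Z x, y⟫_ℂ = ⟪x, Z y⟫_ℂ := fun x y => by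
    simp only [Z, smul_apply, sub_apply, one_apply_eq_self, inner_smul_left, inner_smul_right,
      inner_sub_left, inner_sub_right, h.inner_left hG x y]
    simp
  obtain ⟨z, hz0, hZ⟩ : ∃ z, 0 ≤ z ∧ CommBound W Z z ∧ z = κ * d := by
    refine ⟨κ * d, by positivity, ?_, rfl⟩
    have := ((CommBound.one hW).add (hR.smul (-(r : ℂ)))).smul (κ / r : ℂ)
    have e1 : (κ / r : ℂ) • ((1 : X →L[ℂ] X) + (-(r : ℂ)) • R) = Z := by
      simp [Z, sub_eq_add_neg]
    rw [e1] at this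
    convert this using 1
    rw [norm_neg, ← Complex.ofReal_div, Complex.norm_real, Complex.norm_real,
      Real.norm_of_nonneg hr.le, Real.norm_of_nonneg (by positivity)]
    field_simp
    ring
  -- `D` is the solution of D = (r/s)(d + κd/r + (κ/r)D), so the iteration preserves the bound.
  set D := d * (1 + κ / r) with hD
  let S : Set (X →L[ℂ] X) := {v | ‖v‖ ≤ 1 / r ∧ CommBound W v D}
  have hSc : IsClosed S :=
    (isClosed_le continuous_norm continuous_const).inter (isClosed_setOf_commBound W D)
  let F : (X →L[ℂ] X) → (X →L[ℂ] X) := fun v => (r / s : ℂ) • (R + Z * v)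
  have hrsn : ‖(r / s : ℂ)‖ = r / s := by
    rw [← Complex.ofReal_div, Complex.norm_real, Real.norm_of_nonneg (by positivity)]
  have hsr : s = r + κ := by rw [hκ]; ring
  have hFS : ∀ v ∈ S, F v ∈ S := by
    rintro v ⟨hv, hvD⟩
    refine ⟨?_, ?_⟩
    · calc ‖F v‖ ≤ r / s * (1 / r + κ / r * (1 / r)) := by
            simp only [F]
            rw [norm_smul, hrsn]
            gcongr
            refine (norm_add_le _ _).trans (add_le_add hRn ((norm_mul_le _ _).trans ?_))
            gcongr
        _ = 1 / r := by rw [hsr]; field_simp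
    · have hD0 : 0 ≤ D := by positivity
      have := (hR.add (CommBound.mul hW hd hZa hZ.1 hvD hz0 hD0)).smul (r / s : ℂ)
      refine this.mono ?_
      rw [hrsn, hZ.2]
      calc r / s * (d + (κ * d * ‖v‖ + ‖Z‖ * D))
          ≤ r / s * (d + (κ * d * (1 / r) + κ / r * D)) := by gcongr
        _ = D := by rw [hsr, hD]; field_simp; ring
  have hFc : ∀ v w, ‖F v - F w‖ ≤ κ / s * ‖v - w‖ := fun v w => by
    have : F v - F w = (r / s : ℂ) • (Z * (v - w)) := by
      simp only [F]; rw [← smul_sub, add_sub_add_left_eq_sub, mul_sub]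
    rw [this, norm_smul, hrsn]
    calc r / s * ‖Z * (v - w)‖ ≤ r / s * (κ / r * ‖v - w‖) := by
          gcongr
          exact (norm_mul_le _ _).trans (by gcongr)
      _ = κ / s * ‖v - w‖ := by field_simp
  have hq : κ / s < 1 := by rw [div_lt_one hs]; linarith
  obtain ⟨v, hvS, hv⟩ := exists_fixedPoint_mem hSc hFS (by positivity) hq
    (fun v _ w _ => hFc v w) (x₀ := 0)
    ⟨by simpa using hr.le, CommBound.zero.mono (by positivity)⟩
  have hR' : F R' = R' := by
    ext x
    have h1 := h'.mem x
    have h2 := h'.mem' x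
    have h3 := (h.eq_of_mem hG hr (x := x - (κ : ℂ) • R' x) h1 h2 (by
      rw [hκ]; push_cast; rw [sub_smul]; abel)).1
    rw [map_sub, map_smul] at h3
    change (r / s : ℂ) • (R x + (κ / r : ℂ) • (R' x - (r : ℂ) • R (R' x))) = R' x
    have h4 : R x = R' x + (κ : ℂ) • R (R' x) := sub_eq_iff_eq_add.1 h3
    rw [h4]
    match_scalars
    · field_simp
      rw [hsr]; push_cast; ring
    · field_simp; ring
  have : R' = v := by
    have h1 := hFc R' v
    rw [hR', hv] at h1
    rw [← sub_eq_zero, ← norm_le_zero_iff]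
    by_contra hcon
    push Not at hcon
    nlinarith
  exact ⟨D, this ▸ hvS.2⟩

/-! ### From the commutator with the square to that with its resolvent -/

/-- The form commutator of `W` and the square of `G` is bounded by `c` relative to `G`. -/
def HasRelBoundedSqComm (W G : Submodule ℂ (X × X)) (c : ℝ) : Prop :=
  ∀ f f' f₁ f₂, (f, f') ∈ W → (f, f₁) ∈ G → (f₁, f₂) ∈ G →
    ∃ h, ‖h‖ ≤ c * ‖f₁‖ ∧ ∀ g g' g₁ g₂, (g, g') ∈ W → (g, g₁) ∈ G → (g₁, g₂) ∈ G →
      ⟪g, h⟫_ℂ = ⟪g', f₂⟫_ℂ - ⟪g₂, f'⟫_ℂ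

/-- This is [W, R] = -R [W, L²] R in weak form, with k = [W, L²] R f; the relative bound applies
since L R f = V f. -/
theorem HasRelBoundedSqComm.exists_sqResolvent {G : Submodule ℂ (X × X)} {c : ℝ}
    (hc : HasRelBoundedSqComm W G c) (hG : IsSelfAdjointRelation G)
    (hW : IsSelfAdjointRelation W) {s : ℝ} {R V : X →L[ℂ] X} (h : IsSqResolvent G s R V)
    (hp : ∀ f f', (f, f') ∈ W → ∃ k, (R f, k) ∈ W) {f f' : X} (hf : (f, f') ∈ W) :
    ∃ k, ‖k‖ ≤ c * ‖V f‖ ∧ (R f, R (f' - k)) ∈ W ∧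
      ∀ g g', (g, g') ∈ W → ⟪g', R f⟫_ℂ - ⟪g, R f'⟫_ℂ = -⟪R g, k⟫_ℂ := by
  obtain ⟨m, hm⟩ := hp f f' hf
  obtain ⟨k, hk, hk'⟩ := hc _ _ _ _ hm (h.mem f) (h.mem' f)
  have key : ∀ g g', (g, g') ∈ W → ⟪g', R f⟫_ℂ - ⟪g, R f'⟫_ℂ = -⟪R g, k⟫_ℂ := by
    intro g g' hg
    obtain ⟨n, hn⟩ := hp g g' hg
    rw [hk' _ _ _ _ hn (h.mem g) (h.mem' g)]
    have e1 : ⟪n, f⟫_ℂ = ⟪R g, f'⟫_ℂ := hW.inner_eq hf hn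
    have e2 : ⟪g', R f⟫_ℂ = ⟪g, m⟫_ℂ := hW.inner_eq hm hg
    have e3 : ⟪n, R f⟫_ℂ = ⟪R g, m⟫_ℂ := hW.inner_eq hm hn
    have e4 := h.inner_left hG g f'
    simp only [inner_sub_left, inner_sub_right, inner_smul_left, inner_smul_right,
      Complex.conj_ofReal, e1, e2, e3, e4]
    ring
  refine ⟨k, hk, (hW _ _).2 fun g g' hg => ?_, key⟩
  have := key g g' hg
  rw [map_sub, inner_sub_right, ← h.inner_left hG g k]
  linear_combination this

end
-- Positivity and the Sylvester inequality for bounded operators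
section

variable {X : Type*} [NormedAddCommGroup X] [InnerProductSpace ℂ X]

theorem re_inner_self_eq (x : X) : (⟪x, x⟫_ℂ).re = ‖x‖ ^ 2 := by
  rw [inner_self_eq_norm_sq_to_K]
  norm_cast

theorem re_inner_comm (x y : X) : (⟪x, y⟫_ℂ).re = (⟪y, x⟫_ℂ).re := by
  rw [← inner_conj_symm, Complex.conj_re]

theorem abs_re_inner_le (x y : X) : |(⟪x, y⟫_ℂ).re| ≤ ‖x‖ * ‖y‖ :=
  (Complex.abs_re_le_norm _).trans (norm_inner_le_norm x y)

/-- Positivity of the form of Q is tested on v - M⁻¹ Q v. -/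
theorem norm_apply_sq_le_of_nonneg {Q : X →L[ℂ] X} (hQ : ∀ x y, ⟪Q x, y⟫_ℂ = ⟪x, Q y⟫_ℂ)
    (hQ0 : ∀ x, 0 ≤ (⟪x, Q x⟫_ℂ).re) {M : ℝ} (hM : 0 < M) (hQM : ‖Q‖ ≤ M) (v : X) :
    ‖Q v‖ ^ 2 ≤ M * (⟪v, Q v⟫_ℂ).re := by
  have h := hQ0 (v - ((M⁻¹ : ℝ) : ℂ) • Q v)
  have e : ⟪v - ((M⁻¹ : ℝ) : ℂ) • Q v, Q (v - ((M⁻¹ : ℝ) : ℂ) • Q v)⟫_ℂ =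
      ⟪v, Q v⟫_ℂ - ((2 * M⁻¹ : ℝ) : ℂ) * ⟪Q v, Q v⟫_ℂ +
        ((M⁻¹ ^ 2 : ℝ) : ℂ) * ⟪Q v, Q (Q v)⟫_ℂ := by
    simp only [map_sub, map_smul, inner_sub_left, inner_sub_right, inner_smul_left,
      inner_smul_right, Complex.conj_ofReal, ← hQ v (Q v)]
    push_cast; ring
  rw [e, Complex.add_re, Complex.sub_re, Complex.re_ofReal_mul, Complex.re_ofReal_mul,
    re_inner_self_eq] at h
  have h2 : (⟪Q v, Q (Q v)⟫_ℂ).re ≤ M * ‖Q v‖ ^ 2 := by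
    refine (le_abs_self _).trans ((abs_re_inner_le _ _).trans ?_)
    calc ‖Q v‖ * ‖Q (Q v)‖ ≤ ‖Q v‖ * (M * ‖Q v‖) := by
          gcongr
          exact Q.le_of_opNorm_le hQM _
      _ = _ := by ring
  have h3 : M⁻¹ ^ 2 * (⟪Q v, Q (Q v)⟫_ℂ).re ≤ M⁻¹ * ‖Q v‖ ^ 2 :=
    calc _ ≤ M⁻¹ ^ 2 * (M * ‖Q v‖ ^ 2) := by gcongr
      _ = _ := by field_simp
  have h4 : M⁻¹ * ‖Q v‖ ^ 2 ≤ (⟪v, Q v⟫_ℂ).re := by linarith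
  rwa [inv_mul_le_iff₀ hM] at h4

/-- If `B` is coercive, `P` is symmetric and `B P + P B ≥ 0`, then `P ≥ 0`. -/
theorem nonneg_of_lyapunov {B P : X →L[ℂ] X} (hP : ∀ x y, ⟪P x, y⟫_ℂ = ⟪x, P y⟫_ℂ) {ε : ℝ}
    (hε : 0 < ε) (hB : ∀ f, ε * ‖f‖ ^ 2 ≤ (⟪f, B f⟫_ℂ).re)
    (hBP : ∀ f, 0 ≤ (⟪B f, P f⟫_ℂ).re) (f : X) : 0 ≤ (⟪f, P f⟫_ℂ).re := by
  by_contra hf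
  push Not at hf
  have hf0 : f ≠ 0 := by rintro rfl; simp at hf
  have hfn : 0 < ‖f‖ := norm_pos_iff.2 hf0
  set S : Set ℝ := (fun g : X => (⟪g, P g⟫_ℂ).re) '' {g | ‖g‖ = 1} with hS
  have hbdd : BddBelow S := ⟨-‖P‖, by
    rintro _ ⟨g, hg, rfl⟩
    have h1 := (abs_le.1 (abs_re_inner_le g (P g))).1
    have h2 := P.le_opNorm g
    rw [Set.mem_ofPred_eq] at hg
    rw [hg] at h1 h2
    simp only at h1 ⊢
    linarith⟩
  have hscale : ∀ g : X, g ≠ 0 → (⟪g, P g⟫_ℂ).re / ‖g‖ ^ 2 ∈ S := by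
    intro g hg
    have hgn : 0 < ‖g‖ := norm_pos_iff.2 hg
    refine ⟨((‖g‖⁻¹ : ℝ) : ℂ) • g, ?_, ?_⟩
    · rw [Set.mem_ofPred_eq, norm_smul, Complex.norm_real, norm_inv, norm_norm,
        inv_mul_cancel₀ hgn.ne']
    · simp only [map_smul, inner_smul_left, inner_smul_right, Complex.conj_ofReal,
        Complex.re_ofReal_mul]
      field_simp
  set m := sInf S with hm
  have hm0 : m < 0 := (csInf_le hbdd (hscale f hf0)).trans_lt (by
    apply div_neg_of_neg_of_pos hf; positivity)
  have hQ0 : ∀ g, 0 ≤ (⟪g, (P - (m : ℂ) • 1) g⟫_ℂ).re := by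
    intro g
    rcases eq_or_ne g 0 with rfl | hg
    · simp
    have h1 := csInf_le hbdd (hscale g hg)
    have hgn : 0 < ‖g‖ := norm_pos_iff.2 hg
    rw [← hm, le_div_iff₀ (by positivity)] at h1
    simp only [sub_apply, smul_apply, one_apply_eq_self, inner_sub_right, inner_smul_right,
      Complex.sub_re, Complex.re_ofReal_mul, re_inner_self_eq]
    linarith
  set Q : X →L[ℂ] X := P - (m : ℂ) • 1 with hQdef
  have hQ : ∀ x y, ⟪Q x, y⟫_ℂ = ⟪x, Q y⟫_ℂ := fun x y => by
    simp [Q, hP x y]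
  set K := ‖B‖ ^ 2 * (‖Q‖ + 1) with hK
  have hK0 : 0 ≤ K := by positivity
  have hmε : 0 < (m * ε) ^ 2 := by
    have := mul_neg_of_neg_of_pos hm0 hε
    exact sq_pos_of_neg this
  -- A unit vector nearly attaining the infimum m < 0 of the form of P is almost an eigenvector,
  -- since Q = P - m ≥ 0 makes Q v small. Then Re⟪B v, P v⟫ is close to m Re⟪v, B v⟫ ≤ mε < 0,
  -- against `hBP`; the margin (mε)²/(K + 1) is small enough for this.
  obtain ⟨_, ⟨v, hv, rfl⟩, hv2⟩ := exists_lt_of_csInf_lt (⟨_, hscale f hf0⟩ : S.Nonempty)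
    (show sInf S < m + (m * ε) ^ 2 / (K + 1) by
      rw [← hm]; linarith [div_pos hmε (by positivity : 0 < K + 1)])
  rw [Set.mem_ofPred_eq] at hv
  have hPv : P v = Q v + (m : ℂ) • v := by simp [Q]
  have h1 := norm_apply_sq_le_of_nonneg hQ hQ0 (by positivity : 0 < ‖Q‖ + 1) (by linarith) v
  have h2 : (⟪v, Q v⟫_ℂ).re ≤ (m * ε) ^ 2 / (K + 1) := by
    have : (⟪v, P v⟫_ℂ).re = (⟪v, Q v⟫_ℂ).re + m := by
      rw [hPv, inner_add_right, inner_smul_right, Complex.add_re, Complex.re_ofReal_mul,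
        re_inner_self_eq, hv]
      ring
    simp only at hv2
    linarith
  have h3 := hBP v
  rw [hPv, inner_add_right, inner_smul_right, Complex.add_re, Complex.re_ofReal_mul,
    re_inner_comm (B v) v] at h3
  have h4 := hB v
  rw [hv] at h4
  have h5 := (abs_le.1 (abs_re_inner_le (B v) (Q v))).2
  have h6 := B.le_opNorm v
  rw [hv, mul_one] at h6
  have h7 : -(m * ε) ≤ ‖B‖ * ‖Q v‖ := by
    have : ‖B v‖ * ‖Q v‖ ≤ ‖B‖ * ‖Q v‖ := by gcongr
    nlinarith
  have h8 : (m * ε) ^ 2 ≤ (‖B‖ * ‖Q v‖) ^ 2 := by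
    rw [← neg_sq (m * ε)]
    have := mul_neg_of_neg_of_pos hm0 hε
    gcongr
    linarith
  have h9 : (m * ε) ^ 2 ≤ K * ((m * ε) ^ 2 / (K + 1)) := by
    refine h8.trans ?_
    rw [mul_pow, hK, mul_assoc]
    gcongr
    exact h1.trans (by gcongr)
  rw [mul_div_assoc', le_div_iff₀ (by positivity)] at h9
  linarith

/-- A skew-symmetric `C` with `‖(B C + C B) f‖ ≤ c ‖B f‖` for a coercive symmetric `B`
has its form bounded by `c / 2`, here on one side. -/
theorem re_inner_le_of_sylvester {B C : X →L[ℂ] X} (hB : ∀ x y, ⟪B x, y⟫_ℂ = ⟪x, B y⟫_ℂ)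
    {ε : ℝ} (hε : 0 < ε) (hBε : ∀ f, ε * ‖f‖ ^ 2 ≤ (⟪f, B f⟫_ℂ).re)
    (hC : ∀ x y, ⟪C x, y⟫_ℂ = -⟪x, C y⟫_ℂ) {c : ℝ} (hc : 0 < c)
    (hN : ∀ f, ‖B (C f) + C (B f)‖ ≤ c * ‖B f‖) {σ : ℂ} (hσ : ‖σ‖ = 1)
    (hσ' : (starRingEnd ℂ) σ = -σ) (f : X) : (⟪f, σ • C f⟫_ℂ).re ≤ c / 2 * ‖f‖ ^ 2 := by
  set M : X →L[ℂ] X := σ • C with hMdef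
  have hM : ∀ x y, ⟪M x, y⟫_ℂ = ⟪x, M y⟫_ℂ := fun x y => by
    simp only [M, smul_apply, inner_smul_left, inner_smul_right, hσ', hC x y]
    ring
  have hMN : ∀ f, ‖B (M f) + M (B f)‖ ≤ c * ‖B f‖ := fun f => by
    simp only [M, smul_apply, map_smul]
    rw [← smul_add, norm_smul, hσ, one_mul]
    exact hN f
  set P : X →L[ℂ] X := (c : ℂ) • B - (B * M + M * B) with hPdef
  have hPf : ∀ f, P f = (c : ℂ) • B f - (B (M f) + M (B f)) := fun f => rfl
  have hP : ∀ x y, ⟪P x, y⟫_ℂ = ⟪x, P y⟫_ℂ := fun x y => by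
    simp only [hPf, inner_sub_left, inner_sub_right, inner_add_left, inner_add_right,
      inner_smul_left, inner_smul_right, Complex.conj_ofReal, hB, hM]
    ring
  -- Expanding ‖cBf - Pf‖² ≤ (c‖Bf‖)² leaves ‖Pf‖² ≤ 2c Re⟪Bf, Pf⟫.
  have h1 : ∀ f, 0 ≤ (⟪B f, P f⟫_ℂ).re := fun f => by
    have e : B (M f) + M (B f) = (c : ℂ) • B f - P f := by rw [hPf]; abel
    have h2 := hMN f
    rw [e] at h2
    have h3 := norm_sub_sq (𝕜 := ℂ) ((c : ℂ) • B f) (P f)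
    rw [inner_smul_left, Complex.conj_ofReal, norm_smul, Complex.norm_real,
      Real.norm_of_nonneg hc.le, RCLike.re_eq_complex_re, Complex.re_ofReal_mul] at h3
    have h4 : ‖(c : ℂ) • B f - P f‖ ^ 2 ≤ (c * ‖B f‖) ^ 2 := by gcongr
    have h5 : 0 ≤ 2 * c * (⟪B f, P f⟫_ℂ).re := by nlinarith [sq_nonneg ‖P f‖]
    exact nonneg_of_mul_nonneg_right h5 (by positivity)
  have h2 := nonneg_of_lyapunov hP hε hBε h1
  set Q : X →L[ℂ] X := ((c / 2 : ℝ) : ℂ) • 1 - M with hQdef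
  have hQf : ∀ f, Q f = ((c / 2 : ℝ) : ℂ) • f - M f := fun f => rfl
  have hQ : ∀ x y, ⟪Q x, y⟫_ℂ = ⟪x, Q y⟫_ℂ := fun x y => by
    simp only [hQf, inner_sub_left, inner_sub_right, inner_smul_left, inner_smul_right,
      Complex.conj_ofReal, hM]
  -- Since P = BQ + QB, the form of P at f is 2 Re⟪Bf, Qf⟫, and the Lyapunov argument applies again.
  have h3 : ∀ f, 0 ≤ (⟪B f, Q f⟫_ℂ).re := fun f => by
    have h4 := h2 f
    rw [hPf, inner_sub_right, inner_add_right, inner_smul_right, ← hB f (M f), ← hM f (B f),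
      Complex.sub_re, Complex.add_re, Complex.re_ofReal_mul, re_inner_comm (M f)] at h4
    rw [hQf, inner_sub_right, inner_smul_right, Complex.sub_re, Complex.re_ofReal_mul,
      re_inner_comm _ f]
    linarith
  have h4 := nonneg_of_lyapunov hQ hε hBε h3 f
  rw [hQf, inner_sub_right, inner_smul_right, Complex.sub_re, Complex.re_ofReal_mul,
    re_inner_self_eq] at h4
  have : M f = σ • C f := rfl
  rw [this] at h4
  linarith

/-- Applying the one-sided bound to σ = i and σ = -i gives 0 ≤ Q ≤ c for Q = c/2 - iC. Hence ‖Q‖ ≤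
c, and the triangle inequality costs the factor 3. -/
theorem norm_apply_le_of_sylvester {B C : X →L[ℂ] X} (hB : ∀ x y, ⟪B x, y⟫_ℂ = ⟪x, B y⟫_ℂ)
    {ε : ℝ} (hε : 0 < ε) (hBε : ∀ f, ε * ‖f‖ ^ 2 ≤ (⟪f, B f⟫_ℂ).re)
    (hC : ∀ x y, ⟪C x, y⟫_ℂ = -⟪x, C y⟫_ℂ) {c : ℝ} (hc : 0 < c)
    (hN : ∀ f, ‖B (C f) + C (B f)‖ ≤ c * ‖B f‖) (f : X) : ‖C f‖ ≤ 3 * c / 2 * ‖f‖ := by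
  have hp := re_inner_le_of_sylvester hB hε hBε hC hc hN (σ := Complex.I) (by simp) (by simp)
  have hm := re_inner_le_of_sylvester hB hε hBε hC hc hN (σ := -Complex.I) (by simp) (by simp)
  set Q : X →L[ℂ] X := ((c / 2 : ℝ) : ℂ) • 1 - Complex.I • C with hQdef
  have hQf : ∀ f, Q f = ((c / 2 : ℝ) : ℂ) • f - Complex.I • C f := fun f => rfl
  have hQ : ∀ x y, ⟪Q x, y⟫_ℂ = ⟪x, Q y⟫_ℂ := fun x y => by
    simp only [hQf, inner_sub_left, inner_sub_right, inner_smul_left, inner_smul_right,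
      Complex.conj_ofReal, hC, Complex.conj_I]
    ring
  have hre : ∀ f, (⟪f, Q f⟫_ℂ).re = c / 2 * ‖f‖ ^ 2 - (⟪f, Complex.I • C f⟫_ℂ).re := fun f => by
    rw [hQf, inner_sub_right, inner_smul_right, Complex.sub_re, Complex.re_ofReal_mul,
      re_inner_self_eq]
  have hQ0 : ∀ f, 0 ≤ (⟪f, Q f⟫_ℂ).re := fun f => by
    rw [hre]; linarith [hp f]
  have hQ1 : ∀ f, (⟪f, Q f⟫_ℂ).re ≤ c * ‖f‖ ^ 2 := fun f => by
    have := hm f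
    rw [neg_smul, inner_neg_right, Complex.neg_re] at this
    rw [hre]; linarith
  have hQn : ‖Q‖ ≤ c := by
    by_contra hcon
    push Not at hcon
    have hQpos : 0 < ‖Q‖ := hc.trans hcon
    -- From ‖Qv‖² ≤ ‖Q‖ ⟪v, Qv⟫ ≤ ‖Q‖ c ‖v‖².
    have h1 : ‖Q‖ ≤ √(‖Q‖ * c) := opNorm_le_bound _ (Real.sqrt_nonneg _) fun v => by
      refine le_of_sq_le_sq ?_ (by positivity)
      rw [mul_pow, Real.sq_sqrt (by positivity), mul_assoc]
      refine (norm_apply_sq_le_of_nonneg hQ hQ0 hQpos le_rfl v).trans ?_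
      gcongr
      exact hQ1 v
    have h2 : ‖Q‖ ^ 2 ≤ ‖Q‖ * c := by
      rw [← Real.sq_sqrt (show 0 ≤ ‖Q‖ * c by positivity)]
      gcongr
    nlinarith
  have e : ‖C f‖ = ‖((c / 2 : ℝ) : ℂ) • f - Q f‖ := by
    rw [hQf, sub_sub_cancel, norm_smul, Complex.norm_I, one_mul]
  rw [e]
  refine (norm_sub_le _ _).trans ?_
  have h3 := Q.le_of_opNorm_le hQn f
  rw [norm_smul, Complex.norm_real, Real.norm_of_nonneg (by positivity)]
  linarith

/-! ### Square roots by a contractive iteration -/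

variable [CompleteSpace X] {G W : Submodule ℂ (X × X)}

/-- The positive square root of the bounded operator `s (L² + e) (L² + s)⁻¹`. -/
theorem IsSqResolvent.exists_sqrt (hG : IsSelfAdjointRelation G) (hW : IsSelfAdjointRelation W)
    (hd : Dense {f : X | ∃ f', (f, f') ∈ W}) {s e : ℝ} (he : 0 < e) (hes : e < s)
    {R V : X →L[ℂ] X} (h : IsSqResolvent G s R V) {d : ℝ} (hd0 : 0 ≤ d)
    (hR : CommBound W R d) :
    ∃ B : X →L[ℂ] X, (∀ x y, ⟪B x, y⟫_ℂ = ⟪x, B y⟫_ℂ) ∧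
      (∀ f f', (f, f') ∈ G → (B f, B f') ∈ G) ∧
      (∃ ε > 0, ∀ f, ε * ‖f‖ ^ 2 ≤ (⟪f, B f⟫_ℂ).re) ∧ (∃ d', 0 ≤ d' ∧ CommBound W B d') ∧
      ∀ f, B (B f) = (s : ℂ) • f - ((s * (s - e) : ℝ) : ℂ) • R f := by
  have hs : 0 < s := he.trans hes
  have hse : 0 < s - e := sub_pos.2 hes
  set θ := √(e / s) with hθ
  have hθ0 : 0 < θ := Real.sqrt_pos.2 (by positivity)
  have hθ2 : θ ^ 2 = e / s := Real.sq_sqrt (by positivity)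
  have hθ1 : θ < 1 := by
    have : θ ^ 2 < 1 := by rw [hθ2, div_lt_one hs]; exact hes
    nlinarith
  -- A fixed point of u = (y + u²)/2 satisfies (1 - u)² = 1 - y, so B = √s(1 - u) is the root
  -- sought. As ‖y‖ ≤ 1 - θ², the ball of radius 1 - θ is preserved; θ > 0, from e > 0, gives both
  -- contraction and coercivity.
  set y : X →L[ℂ] X := ((s - e : ℝ) : ℂ) • R with hy
  have hyn : ‖y‖ ≤ 1 - θ ^ 2 := opNorm_le_bound _ (by nlinarith) fun x => by
    have h1 := (h.norm_le hG hs x).1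
    rw [hy, smul_apply, norm_smul, Complex.norm_real, Real.norm_of_nonneg hse.le, hθ2]
    have : (s - e) * ‖R x‖ = (1 - e / s) * (s * ‖R x‖) := by field_simp
    rw [this]
    have : 0 ≤ 1 - e / s := by rw [sub_nonneg, div_le_one hs]; exact hes.le
    gcongr
  obtain ⟨dy, hdy0, hyd⟩ : ∃ dy, 0 ≤ dy ∧ CommBound W y dy := ⟨_, by positivity, hR.smul _⟩
  -- `D` solves D = (dy + 2(1 - θ)D)/2, so the iteration keeps this commutator bound.
  set D := dy / (2 * θ) with hD
  have hD0 : 0 ≤ D := by positivity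
  let S : Set (X →L[ℂ] X) := {u | ‖u‖ ≤ 1 - θ} ∩ {u | ∀ x z, ⟪u x, z⟫_ℂ = ⟪x, u z⟫_ℂ} ∩
    {u | ∀ f f', (f, f') ∈ G → (u f, u f') ∈ G} ∩ {u | CommBound W u D}
  have hSc : IsClosed S := by
    refine (((isClosed_le continuous_norm continuous_const).inter ?_).inter ?_).inter
      (isClosed_setOf_commBound W D)
    · simp only [Set.ofPred_forall]
      exact isClosed_iInter fun x => isClosed_iInter fun z =>
        isClosed_eq (by fun_prop) (by fun_prop)
    · simp only [Set.ofPred_forall]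
      exact isClosed_iInter fun f => isClosed_iInter fun f' => isClosed_iInter fun _ =>
        hG.isClosed.preimage (f := fun u : X →L[ℂ] X => (u f, u f')) (by fun_prop)
  let F : (X →L[ℂ] X) → (X →L[ℂ] X) := fun u => (1 / 2 : ℂ) • (y + u * u)
  have hhalf : ‖(1 / 2 : ℂ)‖ = 1 / 2 := by norm_num
  have hFS : ∀ u ∈ S, F u ∈ S := by
    rintro u ⟨⟨⟨hu1, hu2⟩, hu3⟩, hu4⟩
    simp only [Set.mem_ofPred_eq] at hu1 hu2 hu3 hu4
    refine ⟨⟨⟨?_, ?_⟩, ?_⟩, ?_⟩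
    · rw [Set.mem_ofPred_eq]
      calc ‖F u‖ ≤ 1 / 2 * ((1 - θ ^ 2) + (1 - θ) * (1 - θ)) := by
            simp only [F]
            rw [norm_smul, hhalf]
            gcongr
            refine (norm_add_le _ _).trans (add_le_add hyn ((norm_mul_le _ _).trans ?_))
            gcongr
        _ = 1 - θ := by ring
    · intro x z
      change ⟪(1 / 2 : ℂ) • (((s - e : ℝ) : ℂ) • R x + u (u x)), z⟫_ℂ =
        ⟪x, (1 / 2 : ℂ) • (((s - e : ℝ) : ℂ) • R z + u (u z))⟫_ℂ
      simp only [inner_smul_left, inner_smul_right, inner_add_left, inner_add_right,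
        Complex.conj_ofReal, h.inner_left hG, hu2]
      congr 1
      simp only [one_div, map_inv₀, map_ofNat]
    · intro f f' hf
      exact mem_smul_pair (mem_add_pair (mem_smul_pair (h.map_mem hG hs hf) _)
        (hu3 _ _ (hu3 _ _ hf))) _
    · have := (hyd.add (CommBound.mul hW hd hu2 hu4 hu4 hD0 hD0)).smul (1 / 2 : ℂ)
      refine this.mono ?_
      rw [hhalf]
      calc 1 / 2 * (dy + (D * ‖u‖ + ‖u‖ * D))
          ≤ 1 / 2 * (dy + (D * (1 - θ) + (1 - θ) * D)) := by gcongr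
        _ = D := by rw [hD]; field_simp; ring
  obtain ⟨u, ⟨⟨⟨hu1, hu2⟩, hu3⟩, hu4⟩, hu⟩ := exists_fixedPoint_mem hSc hFS
    (q := 1 - θ) (by linarith) (by linarith) (fun v hv w hw => by
      have e1 : F v - F w = (1 / 2 : ℂ) • (v * (v - w) + (v - w) * w) := by
        simp only [F]; rw [← smul_sub]; congr 1; noncomm_ring
      have hv1 : ‖v‖ ≤ 1 - θ := hv.1.1.1
      have hw1 : ‖w‖ ≤ 1 - θ := hw.1.1.1
      rw [e1, norm_smul, hhalf]
      calc 1 / 2 * ‖v * (v - w) + (v - w) * w‖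
          ≤ 1 / 2 * ((1 - θ) * ‖v - w‖ + ‖v - w‖ * (1 - θ)) := by
            gcongr
            refine (norm_add_le _ _).trans (add_le_add ((norm_mul_le _ _).trans ?_)
              ((norm_mul_le _ _).trans ?_)) <;> gcongr
        _ = _ := by ring) (x₀ := 0)
    ⟨⟨⟨by simpa using hθ1.le, by simp⟩, fun _ _ _ => G.zero_mem⟩, CommBound.zero.mono hD0⟩
  simp only [Set.mem_ofPred_eq] at hu1 hu2 hu3 hu4
  have huf : ∀ f, u f = (1 / 2 : ℂ) • (((s - e : ℝ) : ℂ) • R f + u (u f)) := fun f =>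
    (congrArg (fun T : X →L[ℂ] X => T f) hu).symm
  have hBf : ∀ f, ((√s : ℂ) • (1 - u)) f = (√s : ℂ) • (f - u f) := fun f => rfl
  refine ⟨(√s : ℂ) • (1 - u), ?_, ?_, ⟨√s * θ, mul_pos (Real.sqrt_pos.2 hs) hθ0, ?_⟩, ?_, ?_⟩
  · intro x z
    simp only [hBf, inner_smul_left, inner_smul_right, inner_sub_left, inner_sub_right,
      Complex.conj_ofReal, hu2]
  · intro f f' hf
    exact mem_smul_pair (mem_sub_pair hf (hu3 _ _ hf)) _
  · intro f
    rw [hBf, inner_smul_right, Complex.re_ofReal_mul, inner_sub_right, Complex.sub_re,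
      re_inner_self_eq, mul_assoc]
    have h1 := (abs_le.1 (abs_re_inner_le f (u f))).2
    have h2 : ‖f‖ * ‖u f‖ ≤ ‖f‖ * ((1 - θ) * ‖f‖) := by
      gcongr
      exact u.le_of_opNorm_le hu1 f
    gcongr
    nlinarith
  · have := (((CommBound.one hW).add (hu4.smul (-1))).smul (√s : ℂ))
    have e1 : (√s : ℂ) • ((1 : X →L[ℂ] X) + (-1 : ℂ) • u) = (√s : ℂ) • (1 - u) := by
      simp [sub_eq_add_neg]
    rw [e1] at this
    exact ⟨_, by positivity, this⟩
  · intro f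
    have h2 : u (u f) = (2 : ℂ) • u f - ((s - e : ℝ) : ℂ) • R f := by
      conv_rhs => rw [huf f]
      module
    have hss : (√s : ℂ) * √s = s := by
      rw [← Complex.ofReal_mul, Real.mul_self_sqrt hs.le]
    rw [hBf, hBf, map_smul, map_sub, ← smul_sub, smul_smul, hss, h2, Complex.ofReal_mul]
    module

end
-- Uniform commutator bounds and the limit
section

variable {X : Type*} [NormedAddCommGroup X] [InnerProductSpace ℂ X] {G W : Submodule ℂ (X × X)}

/-- In fact ‖Bf‖² = s‖L²Rf‖² + s²‖Vf‖² + se(‖Vf‖² + s‖Rf‖²). This converts the bound by ‖Vf‖ into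
one by ‖Bf‖ uniformly in s. -/
theorem IsSqResolvent.norm_smul_V_le_of_sq_eq (hG : IsSelfAdjointRelation G) {s e : ℝ}
    (he : 0 ≤ e) (hs : 0 < s) {R V B : X →L[ℂ] X} (h : IsSqResolvent G s R V)
    (hB : ∀ x y, ⟪B x, y⟫_ℂ = ⟪x, B y⟫_ℂ)
    (hBB : ∀ f, B (B f) = (s : ℂ) • f - ((s * (s - e) : ℝ) : ℂ) • R f) (f : X) :
    s * ‖V f‖ ≤ ‖B f‖ := by
  refine le_of_sq_le_sq ?_ (norm_nonneg _)
  have h1 : ‖B f‖ ^ 2 = s * ‖f‖ ^ 2 - s * (s - e) * (‖V f‖ ^ 2 + s * ‖R f‖ ^ 2) := by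
    rw [← re_inner_self_eq, hB, hBB, inner_sub_right, inner_smul_right, inner_smul_right,
      Complex.sub_re, Complex.re_ofReal_mul, Complex.re_ofReal_mul, re_inner_self_eq,
      ← h.inner_left hG, h.inner_apply hG, Complex.add_re, Complex.re_ofReal_mul,
      re_inner_self_eq, re_inner_self_eq]
  have h2 := hG.norm_sq_add (h.mem f) (h.mem' f) s
  rw [sub_add_cancel] at h2
  rw [h1, h2]
  have h3 : 0 ≤ s * ‖f - (s : ℂ) • R f‖ ^ 2 := by positivity
  have h4 : 0 ≤ s * e * (‖V f‖ ^ 2 + s * ‖R f‖ ^ 2) := by positivity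
  nlinarith

/-- Cauchy-Schwarz for the form of a non-negative self-adjoint operator. -/
theorem norm_inner_sq_le_of_nonneg (hG : IsSelfAdjointRelation G)
    (hG0 : ∀ f f', (f, f') ∈ G → 0 ≤ (⟪f, f'⟫_ℂ).re) {g g' h h' : X} (hg : (g, g') ∈ G)
    (hh : (h, h') ∈ G) : ‖⟪g', h⟫_ℂ‖ ^ 2 ≤ (⟪g, g'⟫_ℂ).re * (⟪h, h'⟫_ℂ).re := by
  obtain ⟨z, hz, hz'⟩ : ∃ z : ℂ, ‖z‖ = 1 ∧ z * ⟪g', h⟫_ℂ = ‖⟪g', h⟫_ℂ‖ := by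
    rcases eq_or_ne ⟪g', h⟫_ℂ 0 with h0 | h0
    · exact ⟨1, by simp, by simp [h0]⟩
    · have hn : (‖⟪g', h⟫_ℂ‖ : ℂ) ≠ 0 := by simpa using h0
      refine ⟨‖⟪g', h⟫_ℂ‖ / ⟪g', h⟫_ℂ, ?_, by field_simp⟩
      rw [norm_div, Complex.norm_real, norm_norm, div_self]
      simpa using h0
  have key : ∀ t : ℝ, 0 ≤ (⟪g, g'⟫_ℂ).re * (t * t) + 2 * ‖⟪g', h⟫_ℂ‖ * t + (⟪h, h'⟫_ℂ).re := by
    intro t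
    have h1 := hG0 _ _ (mem_add_pair (mem_smul_pair hg (t : ℂ)) (mem_smul_pair hh z))
    have e1 : ⟪g, h'⟫_ℂ = ⟪g', h⟫_ℂ := (hG.inner_eq hh hg).symm
    have e2 : ⟪h, g'⟫_ℂ = (starRingEnd ℂ) ⟪g', h⟫_ℂ := (inner_conj_symm _ _).symm
    have e3 : (starRingEnd ℂ) z * z = 1 := by
      rw [← Complex.normSq_eq_conj_mul_self, Complex.normSq_eq_norm_sq, hz]; simp
    have e4 : (starRingEnd ℂ) z * (starRingEnd ℂ) ⟪g', h⟫_ℂ = ‖⟪g', h⟫_ℂ‖ := by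
      rw [← map_mul, hz', Complex.conj_ofReal]
    have e : ⟪(t : ℂ) • g + z • h, (t : ℂ) • g' + z • h'⟫_ℂ =
        ((t * t : ℝ) : ℂ) * ⟪g, g'⟫_ℂ + ((2 * ‖⟪g', h⟫_ℂ‖ * t : ℝ) : ℂ) + ⟪h, h'⟫_ℂ := by
      simp only [inner_add_left, inner_add_right, inner_smul_left, inner_smul_right,
        Complex.conj_ofReal, e1, e2]
      push_cast
      linear_combination (t : ℂ) * hz' + (t : ℂ) * e4 + ⟪h, h'⟫_ℂ * e3
    rw [e, Complex.add_re, Complex.add_re, Complex.re_ofReal_mul, Complex.ofReal_re] at h1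
    linarith
  have := discrim_le_zero key
  rw [discrim] at this
  linarith

/-- The orthogonal complement of the range is the kernel. -/
theorem dense_range_of_injective [CompleteSpace X] (hG : IsSelfAdjointRelation G)
    (hG0 : ∀ f, (f, (0 : X)) ∈ G → f = 0) : Dense {g' : X | ∃ g, (g, g') ∈ G} := by
  have e : {g' : X | ∃ g, (g, g') ∈ G} = (G.map (LinearMap.snd ℂ X X) : Set X) := by
    ext g'
    simp
  rw [e, Submodule.dense_iff_topologicalClosure_eq_top, Submodule.topologicalClosure_eq_top_iff,
    Submodule.eq_bot_iff]
  intro x hx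
  refine hG0 x ((hG _ _).2 fun a b hab => ?_)
  rw [inner_zero_right]
  exact (Submodule.mem_orthogonal _ _).1 hx b ⟨(a, b), hab, rfl⟩

theorem tendsto_inner_of_dense {ι : Type*} {l : Filter ι} {u : ι → X} {P : Set X} (hP : Dense P)
    {K : ℝ} (hu : ∀ᶠ i in l, ‖u i‖ ≤ K)
    (h : ∀ x ∈ P, Tendsto (fun i => ⟪x, u i⟫_ℂ) l (𝓝 0)) (x : X) :
    Tendsto (fun i => ⟪x, u i⟫_ℂ) l (𝓝 0) := by
  rw [Metric.tendsto_nhds]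
  intro ε hε
  obtain ⟨y, hy, hxy⟩ := Metric.mem_closure_iff.1 (hP x) (ε / (2 * (|K| + 1))) (by positivity)
  filter_upwards [hu, (Metric.tendsto_nhds.1 (h y hy)) (ε / 2) (by positivity)] with i hi hi'
  rw [dist_zero_right] at hi' ⊢
  have e : ⟪x, u i⟫_ℂ = ⟪x - y, u i⟫_ℂ + ⟪y, u i⟫_ℂ := by rw [inner_sub_left]; ring
  have h1 : ‖⟪x - y, u i⟫_ℂ‖ ≤ ε / 2 := by
    refine (norm_inner_le_norm _ _).trans ?_
    rw [dist_eq_norm] at hxy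
    calc ‖x - y‖ * ‖u i‖ ≤ ε / (2 * (|K| + 1)) * (|K| + 1) := by
          gcongr
          exact hi.trans (by linarith [le_abs_self K])
      _ = ε / 2 := by field_simp
  rw [e]
  refine (norm_add_le _ _).trans_lt ?_
  linarith

/-- Regularization by `s (L² + s)⁻¹` inside the domain of `W`. -/
theorem HasRelBoundedSqComm.exists_tendsto {c r : ℝ} (hc : HasRelBoundedSqComm W G c)
    (hc0 : 0 ≤ c) (hG : IsSelfAdjointRelation G) (hGd : Dense {f : X | ∃ f', (f, f') ∈ G})
    (hW : IsSelfAdjointRelation W) {R V : ℝ → X →L[ℂ] X}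
    (h : ∀ s > 0, IsSqResolvent G s (R s) (V s))
    (hp : ∀ s ≥ r, ∀ f f', (f, f') ∈ W → ∃ k, (R s f, k) ∈ W) {f f' : X} (hf : (f, f') ∈ W) :
    ∃ k : ℝ → X, Tendsto k atTop (𝓝 f') ∧ ∀ᶠ s : ℝ in atTop, ((s : ℂ) • R s f, k s) ∈ W := by
  have hex : ∀ s : ℝ, ∃ k : X, max r 1 ≤ s → ‖k‖ ≤ c * ‖V s f‖ ∧ (R s f, R s (f' - k)) ∈ W := by
    intro s
    by_cases hs : max r 1 ≤ s
    · have hs1 : 1 ≤ s := (le_max_right _ _).trans hs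
      obtain ⟨k, hk, hk', -⟩ := hc.exists_sqResolvent hG hW (h s (by linarith))
        (hp s ((le_max_left _ _).trans hs)) hf
      exact ⟨k, fun _ => ⟨hk, hk'⟩⟩
    · exact ⟨0, fun hs' => absurd hs' hs⟩
  choose k hk using hex
  refine ⟨fun s => (s : ℂ) • R s (f' - k s), ?_, ?_⟩
  · have h1 := tendsto_smul_sqResolvent hG hGd h f'
    -- Here ‖sRk‖ ≤ ‖k‖ ≤ c‖Vf‖ ≤ c‖f‖/√s, so the commutator error disappears in the limit.
    have h2 : Tendsto (fun s : ℝ => (s : ℂ) • R s (k s)) atTop (𝓝 0) := by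
      have h0 : Tendsto (fun s : ℝ => c * ‖f‖ / √s) atTop (𝓝 0) :=
        tendsto_const_nhds.div_atTop Real.tendsto_sqrt_atTop
      refine squeeze_zero_norm' ?_ h0
      filter_upwards [eventually_ge_atTop (max r 1)] with s hs
      have hs1 : 0 < s := zero_lt_one.trans_le ((le_max_right _ _).trans hs)
      have h3 := ((h s hs1).norm_le hG hs1 (k s)).1
      have h4 := ((h s hs1).norm_le hG hs1 f).2.1
      rw [norm_smul, Complex.norm_real, Real.norm_of_nonneg hs1.le,
        le_div_iff₀' (Real.sqrt_pos.2 hs1)]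
      calc √s * (s * ‖R s (k s)‖) ≤ √s * (c * ‖V s f‖) := by
            gcongr ?_ * ?_
            exact h3.trans (hk s hs).1
        _ = c * (√s * ‖V s f‖) := by ring
        _ ≤ c * ‖f‖ := by gcongr
    have h5 := h1.sub h2
    rw [sub_zero] at h5
    refine h5.congr fun s => ?_
    rw [map_sub, smul_sub]
  · filter_upwards [eventually_ge_atTop (max r 1)] with s hs
    exact mem_smul_pair (hk s hs).2 _

variable [CompleteSpace X]

/-- A bounded square root `B` of `s (L² + e) (L² + s)⁻¹` has commutator bounded by `3 c / 2`. -/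
theorem HasRelBoundedSqComm.commBound_sqrt {c : ℝ} (hc : HasRelBoundedSqComm W G c)
    (hc0 : 0 < c) (hG : IsSelfAdjointRelation G) (hW : IsSelfAdjointRelation W)
    (hd : Dense {f : X | ∃ f', (f, f') ∈ W}) {s e : ℝ} (he : 0 ≤ e) (hes : e ≤ s) (hs : 0 < s)
    {R V B : X →L[ℂ] X} (h : IsSqResolvent G s R V)
    (hp : ∀ f f', (f, f') ∈ W → ∃ k, (R f, k) ∈ W)
    (hB : ∀ x y, ⟪B x, y⟫_ℂ = ⟪x, B y⟫_ℂ) {ε : ℝ} (hε : 0 < ε)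
    (hBε : ∀ f, ε * ‖f‖ ^ 2 ≤ (⟪f, B f⟫_ℂ).re)
    (hBB : ∀ f, B (B f) = (s : ℂ) • f - ((s * (s - e) : ℝ) : ℂ) • R f)
    {d : ℝ} (hd0 : 0 ≤ d) (hBd : CommBound W B d) : CommBound W B (3 * c / 2) := by
  let φ : X × X →ₗ[ℂ] X × X × X := (LinearMap.fst ℂ X X).prod
    ((LinearMap.snd ℂ X X).prod (B.toLinearMap ∘ₗ LinearMap.fst ℂ X X))
  have hφ : ∀ f f', (f, f') ∈ W → (f, f', B f) ∈ W.map φ := fun f f' hf => ⟨(f, f'), hf, rfl⟩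
  obtain ⟨C, -, hC⟩ := exists_clm_of_bounded_form (W.map φ)
    (hd.mono (by
      rintro f ⟨f', hf⟩
      exact ⟨_, hφ f f' hf⟩)) hd0 (by
    rintro _ _ _ _ _ _ ⟨⟨f, f'⟩, hf, ⟨⟩⟩ ⟨⟨g, g'⟩, hg, ⟨⟩⟩
    have := hBd _ _ _ _ hf hg
    rw [← hB g f'] at this
    exact this)
  replace hC : ∀ f f' g g', (f, f') ∈ W → (g, g') ∈ W → ⟪g, C f⟫_ℂ = ⟪g', B f⟫_ℂ - ⟪B g, f'⟫_ℂ :=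
    fun f f' g g' hf hg => hC _ _ _ _ _ _ (hφ f f' hf) (hφ g g' hg)
  have hskew : ∀ x y, ⟪C x, y⟫_ℂ = -⟪x, C y⟫_ℂ := by
    have h1 : ∀ x ∈ {f : X | ∃ f', (f, f') ∈ W}, ∀ y ∈ {f : X | ∃ f', (f, f') ∈ W},
        ⟪C x, y⟫_ℂ = -⟪x, C y⟫_ℂ := by
      rintro f ⟨f', hf⟩ g ⟨g', hg⟩
      rw [← inner_conj_symm, hC f f' g g' hf hg, hC g g' f f' hg hf, map_sub, inner_conj_symm,
        inner_conj_symm]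
      ring
    have h2 : ∀ x ∈ {f : X | ∃ f', (f, f') ∈ W}, ∀ y, ⟪C x, y⟫_ℂ = -⟪x, C y⟫_ℂ := fun x hx y =>
      (isClosed_eq (f := fun y => ⟪C x, y⟫_ℂ) (g := fun y => -⟪x, C y⟫_ℂ) (by fun_prop)
        (by fun_prop)).closure_subset_iff.2 (h1 x hx) (hd y)
    intro x y
    exact (isClosed_eq (f := fun x => ⟪C x, y⟫_ℂ) (g := fun x => -⟪x, C y⟫_ℂ) (by fun_prop)
        (by fun_prop)).closure_subset_iff.2 (fun x hx => h2 x hx y) (hd x)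
  have hN : ∀ f, ‖B (C f) + C (B f)‖ ≤ c * ‖B f‖ := by
    have h1 : ∀ f ∈ {f : X | ∃ f', (f, f') ∈ W}, ‖B (C f) + C (B f)‖ ≤ c * ‖B f‖ := by
      rintro f ⟨f', hf⟩
      obtain ⟨k, hk, -, hk'⟩ := hc.exists_sqResolvent hG hW h hp hf
      obtain ⟨m, hm⟩ := hBd.exists_mem hW hd hf
      refine norm_le_of_dense_inner hd (by positivity) ?_
      rintro g ⟨g', hg⟩
      obtain ⟨n, hn⟩ := hBd.exists_mem hW hd hg
      have e1 : ⟪n, B f⟫_ℂ = ⟪B g, m⟫_ℂ := hW.inner_eq hm hn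
      have e2 : ⟪g', f⟫_ℂ = ⟪g, f'⟫_ℂ := hW.inner_eq hf hg
      -- BC + CB is [W, B²] = -s(s - e)[W, R], because B² = s - s(s - e)R.
      have e3 : ⟪g, B (C f) + C (B f)⟫_ℂ = ((s * (s - e) : ℝ) : ℂ) * ⟪R g, k⟫_ℂ := by
        rw [inner_add_right, ← hB, hC _ _ _ _ hf hn, hC _ _ _ _ hm hg, e1, hBB, hBB]
        simp only [inner_sub_left, inner_sub_right, inner_smul_left, inner_smul_right,
          Complex.conj_ofReal, e2, h.inner_left hG g f']
        linear_combination -((s * (s - e) : ℝ) : ℂ) * hk' g g' hg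
      rw [e3, norm_mul, Complex.norm_real,
        Real.norm_of_nonneg (mul_nonneg hs.le (sub_nonneg.2 hes))]
      have h2 := (h.norm_le hG hs g).1
      have h3 := h.norm_smul_V_le_of_sq_eq hG he hs hB hBB f
      calc _ ≤ s * s * (‖R g‖ * (c * ‖V f‖)) := by
            gcongr
            · linarith
            · exact (norm_inner_le_norm _ _).trans (by gcongr)
        _ = c * (s * ‖V f‖) * (s * ‖R g‖) := by ring
        _ ≤ c * ‖B f‖ * ‖g‖ := by gcongr
    intro f
    exact (isClosed_le (f := fun f => ‖B (C f) + C (B f)‖) (g := fun f => c * ‖B f‖)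
      (by fun_prop) (by fun_prop)).closure_subset_iff.2 h1 (hd f)
  intro f f' g g' hf hg
  rw [← hB g f', ← hC f f' g g' hf hg]
  have := norm_apply_le_of_sylvester hB hε hBε hskew hc0 hN f
  calc ‖⟪g, C f⟫_ℂ‖ ≤ ‖g‖ * ‖C f‖ := norm_inner_le_norm _ _
    _ ≤ ‖g‖ * (3 * c / 2 * ‖f‖) := by gcongr
    _ = _ := by ring

/-- Square roots of `s (L² + s⁻¹) (L² + s)⁻¹` converge weakly to `L` on `D(L²)`. -/
theorem tendsto_inner_sqrt (hG : IsSelfAdjointRelation G)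
    (hGd : Dense {f : X | ∃ f', (f, f') ∈ G})
    (hG0 : ∀ f f', (f, f') ∈ G → 0 ≤ (⟪f, f'⟫_ℂ).re)
    (hGi : ∀ f, (f, (0 : X)) ∈ G → f = 0) {R V B : ℝ → X →L[ℂ] X}
    (h : ∀ s > 0, IsSqResolvent G s (R s) (V s))
    (hB : ∀ᶠ s in atTop, (∀ x y, ⟪B s x, y⟫_ℂ = ⟪x, B s y⟫_ℂ) ∧
      (∀ f f', (f, f') ∈ G → (B s f, B s f') ∈ G) ∧ (∀ f, 0 ≤ (⟪f, B s f⟫_ℂ).re) ∧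
      ∀ f, B s (B s f) = (s : ℂ) • f - ((s * (s - s⁻¹) : ℝ) : ℂ) • R s f)
    {f f₁ f₂ : X} (hf : (f, f₁) ∈ G) (hf₁ : (f₁, f₂) ∈ G) (x : X) :
    Tendsto (fun s => ⟪x, B s f⟫_ℂ) atTop (𝓝 ⟪x, f₁⟫_ℂ) := by
  -- With e = s⁻¹, B²f = sR L²f + Rf, and the last term is s⁻¹(sRf).
  have hA : Tendsto (fun s => B s (B s f)) atTop (𝓝 f₂) := by
    have h1 := tendsto_smul_sqResolvent hG hGd h f₂
    have h2 : Tendsto (fun s : ℝ => ((s⁻¹ : ℝ) : ℂ) • ((s : ℂ) • R s f)) atTop (𝓝 0) := by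
      have h3 : Tendsto (fun s : ℝ => ((s⁻¹ : ℝ) : ℂ)) atTop (𝓝 0) := by
        have := (Complex.continuous_ofReal.tendsto 0).comp tendsto_inv_atTop_zero
        rwa [Complex.ofReal_zero] at this
      simpa using h3.smul (tendsto_smul_sqResolvent hG hGd h f)
    have h4 := h1.add h2
    rw [add_zero] at h4
    refine h4.congr' ?_
    filter_upwards [hB, eventually_gt_atTop 0] with s hs hs0
    have e1 : R s f₂ = f - (s : ℂ) • R s f := by
      rw [((h s hs0).apply_of_mem hG hs0 hf₁).1, ((h s hs0).apply_of_mem hG hs0 hf).2]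
    rw [hs.2.2.2 f, e1]
    have hs0' : (s : ℂ) ≠ 0 := by exact_mod_cast hs0.ne'
    push_cast
    match_scalars <;> field_simp
    ring
  have hz : Tendsto (fun s => ‖B s (B s f) - f₂‖) atTop (𝓝 0) := by
    have := (hA.sub_const f₂).norm
    simpa using this
  have hbd : ∀ᶠ s in atTop, ‖B s f - f₁‖ ≤ (‖f‖ + (‖f₂‖ + 1)) + ‖f₁‖ := by
    filter_upwards [hB, hA.norm.eventually (gt_mem_nhds (lt_add_one ‖f₂‖))] with s hs hs'
    have e1 : ‖B s f‖ ^ 2 ≤ ‖f‖ * (‖f₂‖ + 1) := by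
      rw [← re_inner_self_eq, hs.1]
      refine (le_abs_self _).trans ((abs_re_inner_le _ _).trans ?_)
      gcongr
    have e2 : ‖B s f‖ ≤ ‖f‖ + (‖f₂‖ + 1) := by
      refine le_of_sq_le_sq ?_ (by positivity)
      have := norm_nonneg f
      have := norm_nonneg f₂
      nlinarith
    refine (norm_sub_le _ _).trans ?_
    linarith
  have key : ∀ y ∈ {g' : X | ∃ g, (g, g') ∈ G},
      Tendsto (fun s => ⟪y, B s f - f₁⟫_ℂ) atTop (𝓝 0) := by
    rintro g' ⟨g, hg⟩
    set K := (‖f‖ + (‖f₂‖ + 1)) + ‖f₁‖ with hK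
    have hlim : Tendsto (fun s => √((⟪g, g'⟫_ℂ).re * (K * ‖B s (B s f) - f₂‖))) atTop (𝓝 0) := by
      have := ((hz.const_mul K).const_mul (⟪g, g'⟫_ℂ).re).sqrt
      simpa using this
    refine squeeze_zero_norm' ?_ hlim
    filter_upwards [hB, hbd] with s hs hs'
    refine Real.le_sqrt_of_sq_le ?_
    have hh : (B s f - f₁, B s f₁ - f₂) ∈ G := mem_sub_pair (hs.2.1 _ _ hf) hf₁
    refine (norm_inner_sq_le_of_nonneg hG hG0 hg hh).trans ?_
    have hg0 := hG0 _ _ hg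
    gcongr
    -- For h = Bf - Lf this is Lh = (B²f - L²f) - Bh, that is (L + B)(B - L) = B² - L² for commuting
    -- operators. As ⟪h, Bh⟫ ≥ 0, the form ⟪h, Lh⟫ tends to 0, and Cauchy-Schwarz for the form of L
    -- makes h weakly null against the dense range of L.
    have e1 : B s f₁ - f₂ = (B s (B s f) - f₂) - B s (B s f - f₁) := by
      rw [map_sub]; abel
    rw [e1, inner_sub_right, Complex.sub_re]
    have h1 := hs.2.2.1 (B s f - f₁)
    have h2 := (abs_le.1 (abs_re_inner_le (B s f - f₁) (B s (B s f) - f₂))).2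
    have h3 : ‖B s f - f₁‖ * ‖B s (B s f) - f₂‖ ≤ K * ‖B s (B s f) - f₂‖ := by gcongr
    linarith
  have h1 := tendsto_inner_of_dense (dense_range_of_injective hG hGi) hbd key x
  have h2 := h1.add_const ⟪x, f₁⟫_ℂ
  rw [zero_add] at h2
  refine h2.congr fun s => ?_
  rw [inner_sub_right, sub_add_cancel]

/-- The form commutator of `W` and `L` is bounded. -/
theorem HasRelBoundedSqComm.norm_form_le {c r : ℝ} (hc : HasRelBoundedSqComm W G c)
    (hc0 : 0 < c) (hG : IsSelfAdjointRelation G)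
    (hGd : Dense {f : X | ∃ f', (f, f') ∈ G}) (hW : IsSelfAdjointRelation W)
    (hWd : Dense {f : X | ∃ f', (f, f') ∈ W})
    (hG0 : ∀ f f', (f, f') ∈ G → 0 ≤ (⟪f, f'⟫_ℂ).re)
    (hGi : ∀ f, (f, (0 : X)) ∈ G → f = 0) {R V : ℝ → X →L[ℂ] X}
    (h : ∀ s > 0, IsSqResolvent G s (R s) (V s))
    (hR : ∀ s ≥ r, ∃ d, CommBound W (R s) d) {f f' f₁ g g' g₁ : X} (hf : (f, f') ∈ W)
    (hf₁ : (f, f₁) ∈ G) (hg : (g, g') ∈ W) (hg₁ : (g, g₁) ∈ G) :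
    ‖⟪g', f₁⟫_ℂ - ⟪g₁, f'⟫_ℂ‖ ≤ 3 * c / 2 * ‖f‖ * ‖g‖ := by
  have hp : ∀ s ≥ r, ∀ f f', (f, f') ∈ W → ∃ k, (R s f, k) ∈ W := fun s hs f f' hf => by
    obtain ⟨d, hd⟩ := hR s hs
    exact hd.exists_mem hW hWd hf
  have hex : ∀ s : ℝ, ∃ B : X →L[ℂ] X, max r 2 ≤ s → ((∀ x y, ⟪B x, y⟫_ℂ = ⟪x, B y⟫_ℂ) ∧
      (∀ f f', (f, f') ∈ G → (B f, B f') ∈ G) ∧ (∀ f, 0 ≤ (⟪f, B f⟫_ℂ).re) ∧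
      ∀ f, B (B f) = (s : ℂ) • f - ((s * (s - s⁻¹) : ℝ) : ℂ) • R s f) ∧
      CommBound W B (3 * c / 2) := by
    intro s
    -- The threshold 2 ensures s⁻¹ < s; smaller s get the value 0, which does not affect the limit.
    by_cases hs : max r 2 ≤ s
    · have hs2 : 2 ≤ s := (le_max_right _ _).trans hs
      have hsr : r ≤ s := (le_max_left _ _).trans hs
      have hs0 : 0 < s := by linarith
      have hsi : s⁻¹ < s := (inv_lt_one_of_one_lt₀ (by linarith)).trans (by linarith)
      obtain ⟨d, hd⟩ := hR s hsr
      obtain ⟨B, hB, hBG, ⟨ε, hε, hBε⟩, ⟨d', hd', hBd⟩, hBB⟩ := (h s hs0).exists_sqrt hG hW hWd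
        (inv_pos.2 hs0) hsi (abs_nonneg d) (hd.mono (le_abs_self d))
      exact ⟨B, fun _ => ⟨⟨hB, hBG, fun f => (by positivity : (0 : ℝ) ≤ _).trans (hBε f), hBB⟩,
        hc.commBound_sqrt hc0 hG hW hWd (inv_pos.2 hs0).le hsi.le hs0 (h s hs0) (hp s hsr) hB hε
          hBε hBB hd' hBd⟩⟩
    · exact ⟨0, fun hs' => absurd hs' hs⟩
  choose B hB using hex
  have hBev : ∀ᶠ s in atTop, max r 2 ≤ s := eventually_ge_atTop _
  have key : ∀ f f' f₁ f₂ g g' g₁ g₂, (f, f') ∈ W → (f, f₁) ∈ G → (f₁, f₂) ∈ G →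
      (g, g') ∈ W → (g, g₁) ∈ G → (g₁, g₂) ∈ G →
      ‖⟪g', f₁⟫_ℂ - ⟪g₁, f'⟫_ℂ‖ ≤ 3 * c / 2 * ‖f‖ * ‖g‖ := by
    intro f f' f₁ f₂ g g' g₁ g₂ hf hf₁ hf₂ hg hg₁ hg₂
    have hB' := hBev.mono fun s hs => (hB s hs).1
    have t1 := tendsto_inner_sqrt hG hGd hG0 hGi h hB' hf₁ hf₂ g'
    have t2 := tendsto_inner_sqrt hG hGd hG0 hGi h hB' hg₁ hg₂ f'
    have t3 := (Complex.continuous_conj.tendsto _).comp t2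
    rw [inner_conj_symm] at t3
    refine le_of_tendsto (t1.sub t3).norm ?_
    filter_upwards [hBev] with s hs
    rw [Function.comp_apply, inner_conj_symm, (hB s hs).1.1]
    exact (hB s hs).2 _ _ _ _ hf hg
  -- The bound `key` needs vectors of D(L²); sR_s moves f and g there while W and L of the
  -- regularized vectors converge.
  obtain ⟨k, hk, hk'⟩ := hc.exists_tendsto hc0.le hG hGd hW h hp hf
  obtain ⟨l, hl, hl'⟩ := hc.exists_tendsto hc0.le hG hGd hW h hp hg
  have tf := tendsto_smul_sqResolvent hG hGd h f
  have tf₁ := tendsto_smul_sqResolvent hG hGd h f₁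
  have tg := tendsto_smul_sqResolvent hG hGd h g
  have tg₁ := tendsto_smul_sqResolvent hG hGd h g₁
  refine le_of_tendsto_of_tendsto ((hl.inner tf₁).sub (tg₁.inner hk)).norm
    ((tf.norm.const_mul (3 * c / 2)).mul tg.norm) ?_
  filter_upwards [hk', hl', eventually_gt_atTop 0] with s hs hs' hs0
  have aux : ∀ {f f₁ : X}, (f, f₁) ∈ G → ((s : ℂ) • R s f, (s : ℂ) • R s f₁) ∈ G ∧
      ∃ f₂, ((s : ℂ) • R s f₁, f₂) ∈ G := fun {f f₁} hf => by
    refine ⟨mem_smul_pair ((h s hs0).map_mem hG hs0 hf) _, ?_⟩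
    rw [((h s hs0).apply_of_mem hG hs0 hf).1]
    exact ⟨_, mem_smul_pair ((h s hs0).mem' f) _⟩
  obtain ⟨a1, f₂, a2⟩ := aux hf₁
  obtain ⟨b1, g₂, b2⟩ := aux hg₁
  exact key _ _ _ _ _ _ _ _ hs a1 a2 hs' b1 b2

/-- If `[W, L²]` is bounded relative to `L`, with `L` non-negative and injective, then the
commutator `[W, L]` is densely defined and bounded. -/
theorem HasRelBoundedSqComm.dense_and_exists_clm {c r : ℝ} (hc : HasRelBoundedSqComm W G c)
    (hc0 : 0 < c) (hr : 0 < r) (hG : IsSelfAdjointRelation G)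
    (hGd : Dense {f : X | ∃ f', (f, f') ∈ G}) (hW : IsSelfAdjointRelation W)
    (hWd : Dense {f : X | ∃ f', (f, f') ∈ W})
    (hG0 : ∀ f f', (f, f') ∈ G → 0 ≤ (⟪f, f'⟫_ℂ).re)
    (hGi : ∀ f, (f, (0 : X)) ∈ G → f = 0)
    (hp : ∀ f f₁ f₂, (f, f₁) ∈ G → (f₁, f₂) ∈ G → (∃ k, (f₂ + (r : ℂ) • f, k) ∈ W) →
      ∃ k, (f, k) ∈ W) :
    Dense {f : X | ∃ a b k l, (f, a) ∈ G ∧ (a, b) ∈ W ∧ (f, k) ∈ W ∧ (k, l) ∈ G} ∧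
    Dense {f : X | (∃ f', (f, f') ∈ W) ∧ ∃ f₁, (f, f₁) ∈ G} ∧
    ∃ T : X →L[ℂ] X, ∀ f f' f₁ g g' g₁, (f, f') ∈ W → (f, f₁) ∈ G → (g, g') ∈ W → (g, g₁) ∈ G →
      ⟪g, T f⟫_ℂ = ⟪g', f₁⟫_ℂ - ⟪g₁, f'⟫_ℂ := by
  have hRV : ∀ s : ℝ, ∃ R V : X →L[ℂ] X, 0 < s → IsSqResolvent G s R V := fun s => by
    by_cases hs : 0 < s
    · obtain ⟨R, V, h⟩ := hG.exists_isSqResolvent hs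
      exact ⟨R, V, fun _ => h⟩
    · exact ⟨0, 0, fun hs' => absurd hs' hs⟩
  choose R V h using hRV
  have hpr : ∀ f f', (f, f') ∈ W → ∃ k, (R r f, k) ∈ W := fun f f' hf =>
    hp _ _ _ ((h r hr).mem f) ((h r hr).mem' f) ⟨f', by rwa [sub_add_cancel]⟩
  have hRr : CommBound W (R r) (c / (r * √r)) := by
    intro f f' g g' hf hg
    obtain ⟨k, hk, -, hk'⟩ := hc.exists_sqResolvent hG hW (h r hr) hpr hf
    rw [hk' g g' hg, norm_neg]
    have h1 := ((h r hr).norm_le hG hr g).1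
    have h2 := ((h r hr).norm_le hG hr f).2.1
    have hr' := Real.sqrt_pos.2 hr
    rw [div_mul_eq_mul_div, div_mul_eq_mul_div, le_div_iff₀' (by positivity)]
    calc r * √r * ‖⟪R r g, k⟫_ℂ‖ ≤ r * √r * (‖R r g‖ * (c * ‖V r f‖)) := by
          gcongr
          exact (norm_inner_le_norm _ _).trans (by gcongr)
      _ = c * (√r * ‖V r f‖) * (r * ‖R r g‖) := by ring
      _ ≤ c * ‖f‖ * ‖g‖ := by gcongr
  have hR : ∀ s ≥ r, ∃ d, CommBound W (R s) d := fun s hs =>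
    CommBound.sqResolvent_of_le hG hW hWd hr hs (h r hr) (h s (hr.trans_le hs))
      (by positivity) hRr
  have hps : ∀ s ≥ r, ∀ f f', (f, f') ∈ W → ∃ k, (R s f, k) ∈ W := fun s hs f f' hf => by
    obtain ⟨d, hd⟩ := hR s hs
    exact hd.exists_mem hW hWd hf
  -- Every density claim is checked on the vectors sR_s f with f in the domain of W and s ≥ r.
  have hdense : ∀ P : Set X, (∀ f f', (f, f') ∈ W → ∀ s ≥ r, (s : ℂ) • R s f ∈ P) → Dense P := by
    intro P hP x
    have h1 : {f : X | ∃ f', (f, f') ∈ W} ⊆ closure P := by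
      rintro f ⟨f', hf⟩
      refine mem_closure_of_tendsto (tendsto_smul_sqResolvent hG hGd h f) ?_
      filter_upwards [eventually_ge_atTop r] with s hs
      exact hP f f' hf s hs
    exact closure_minimal h1 isClosed_closure (hWd x)
  have hDd : Dense {f : X | (∃ f', (f, f') ∈ W) ∧ ∃ f₁, (f, f₁) ∈ G} := by
    refine hdense _ fun f f' hf s hs => ?_
    obtain ⟨k, hk⟩ := hps s hs f f' hf
    exact ⟨⟨_, mem_smul_pair hk _⟩, _, mem_smul_pair ((h s (hr.trans_le hs)).mem f) _⟩
  let Θ : Submodule ℂ (X × X × X) :=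
    { carrier := {p | (p.1, p.2.1) ∈ W ∧ (p.1, p.2.2) ∈ G}
      zero_mem' := ⟨W.zero_mem, G.zero_mem⟩
      add_mem' := fun h h' => ⟨W.add_mem h.1 h'.1, G.add_mem h.2 h'.2⟩
      smul_mem' := fun a _ h => ⟨W.smul_mem a h.1, G.smul_mem a h.2⟩ }
  obtain ⟨T, -, hT⟩ := exists_clm_of_bounded_form Θ (d := 3 * c / 2)
    (hDd.mono (by
      rintro f ⟨⟨f', hf⟩, f₁, hf₁⟩
      exact ⟨(f', f₁), hf, hf₁⟩))
    (by positivity) (fun f f' f₁ g g' g₁ hf hg =>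
      hc.norm_form_le hc0 hG hGd hW hWd hG0 hGi h hR hf.1 hf.2 hg.1 hg.2)
  replace hT : ∀ f f' f₁ g g' g₁, (f, f') ∈ W → (f, f₁) ∈ G → (g, g') ∈ W → (g, g₁) ∈ G →
      ⟪g, T f⟫_ℂ = ⟪g', f₁⟫_ℂ - ⟪g₁, f'⟫_ℂ := fun f f' f₁ g g' g₁ hf hf₁ hg hg₁ =>
    hT f f' f₁ g g' g₁ ⟨hf, hf₁⟩ ⟨hg, hg₁⟩
  refine ⟨hdense _ fun f f' hf s hs => ?_, hDd, T, hT⟩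
  have hs0 : 0 < s := hr.trans_le hs
  obtain ⟨k, -, hk, -⟩ := hc.exists_sqResolvent hG hW (h s hs0) (hps s hs) hf
  -- The value is read off from W L R f = L W R f + T R f with W R f = R(f' - k). It is tested on g
  -- in D(W) ∩ D(L), then on all of D(W) by regularizing g.
  have hV : (V s f, V s (f' - k) + T (R s f)) ∈ W := by
    have h1 : ∀ g g' g₁, (g, g') ∈ W → (g, g₁) ∈ G →
        ⟪g', V s f⟫_ℂ = ⟪g, V s (f' - k) + T (R s f)⟫_ℂ := by
      intro g g' g₁ hg hg₁
      rw [inner_add_right, hT _ _ _ _ _ _ hk ((h s hs0).mem f) hg hg₁,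
        hG.inner_eq ((h s hs0).mem (f' - k)) hg₁]
      ring
    rw [hW]
    intro g g' hg
    obtain ⟨l, hl, hl'⟩ := hc.exists_tendsto hc0.le hG hGd hW h hps hg
    have t1 := hl.inner (𝕜 := ℂ) (tendsto_const_nhds (x := V s f))
    have t2 := (tendsto_smul_sqResolvent hG hGd h g).inner (𝕜 := ℂ)
      (tendsto_const_nhds (x := V s (f' - k) + T (R s f)))
    refine tendsto_nhds_unique t1 (t2.congr' ?_)
    filter_upwards [hl', eventually_gt_atTop 0] with t ht ht0
    exact (h1 _ _ _ ht (mem_smul_pair ((h t ht0).mem g) _)).symm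
  exact ⟨_, _, _, _, mem_smul_pair ((h s hs0).mem f) _, mem_smul_pair hV _, mem_smul_pair hk _,
    mem_smul_pair ((h s hs0).mem (f' - k)) _⟩

end
-- Translation to partially defined operators and the main theorem
theorem isSelfAdjointRelation_graph {X : Type*} [NormedAddCommGroup X] [InnerProductSpace ℂ X]
    [CompleteSpace X] {A : X →ₗ.[ℂ] X} (hA : IsSelfAdjoint A) :
    IsSelfAdjointRelation A.graph := by
  have h := LinearPMap.adjoint_graph_eq_graph_adjoint hA.dense_domain
  rw [LinearPMap.isSelfAdjoint_def.1 hA] at h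
  intro x y
  rw [h, Submodule.mem_adjoint_iff]
  simp only [sub_eq_zero, ← h]

theorem mk_mem_graph_iff {X : Type*} [NormedAddCommGroup X] [InnerProductSpace ℂ X]
    {A : X →ₗ.[ℂ] X} {x y : X} : (x, y) ∈ A.graph ↔ ∃ h : x ∈ A.domain, A ⟨x, h⟩ = y := by
  rw [LinearPMap.mem_graph_iff]
  constructor
  · rintro ⟨⟨z, hz⟩, rfl, rfl⟩
    exact ⟨hz, rfl⟩
  · rintro ⟨h, rfl⟩
    exact ⟨⟨x, h⟩, rfl, rfl⟩

theorem dense_setOf_mem_graph {X : Type*} [NormedAddCommGroup X] [InnerProductSpace ℂ X]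
    [CompleteSpace X] {A : X →ₗ.[ℂ] X} (hA : IsSelfAdjoint A) :
    Dense {f : X | ∃ f', (f, f') ∈ A.graph} :=
  hA.dense_domain.mono fun f hf => ⟨A ⟨f, hf⟩, mk_mem_graph_iff.2 ⟨hf, rfl⟩⟩

end UnboundedOp

theorem mainTheorem5 {X : Type*} [NormedAddCommGroup X] [InnerProductSpace ℂ X] [CompleteSpace X]
    (L W : X →ₗ.[ℂ] X) (hL : IsSelfAdjoint L) (hW : IsSelfAdjoint W)
    (hL_nonneg : ∀ f : L.domain, 0 ≤ (⟪(f : X), L f⟫_ℂ).re)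
    (hL_null : ∀ f : L.domain, L f = 0 → f = 0)
    -- some resolvent of the square of `L` leaves the domain of `W` invariant
    (hdom : ∃ r : ℝ, 0 < r ∧ ∀ f : (UnboundedOp.mul L L).domain,
      UnboundedOp.mul L L f + (r : ℂ) • (f : X) ∈ W.domain → (f : X) ∈ W.domain)
    (c : ℝ)
    (hc : ∀ (f : X) (_ : f ∈ W.domain) (_ : f ∈ (UnboundedOp.mul L L).domain)
      (hf : f ∈ L.domain),
      ∃ h : X, UnboundedOp.IsWeakCommutatorAt W (UnboundedOp.mul L L) f h ∧
        ‖h‖ ≤ c * ‖L ⟨f, hf⟩‖) :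
    Dense ((UnboundedOp.commutator W L).domain : Set X) ∧
    ∃ T : X →L[ℂ] X,
      (∀ f : (UnboundedOp.commutator W L).domain, UnboundedOp.commutator W L f = T f) ∧
      (∀ f : X, f ∈ W.domain → f ∈ L.domain → UnboundedOp.IsWeakCommutatorAt W L f (T f)) := by
  obtain ⟨r, hr, hdom⟩ := hdom
  -- The constant |c| + 1 is strictly positive, as the Sylvester argument requires.
  have hcomm : UnboundedOp.HasRelBoundedSqComm W.graph L.graph (|c| + 1) := by
    intro f f' f₁ f₂ hf hf₁ hf₂
    obtain ⟨hfW, rfl⟩ := UnboundedOp.mk_mem_graph_iff.1 hf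
    obtain ⟨hfL, rfl⟩ := UnboundedOp.mk_mem_graph_iff.1 hf₁
    obtain ⟨hfLL, rfl⟩ := UnboundedOp.mk_mem_graph_iff.1 hf₂
    obtain ⟨h, ⟨hA, hB, key⟩, hb⟩ := hc f hfW (UnboundedOp.mem_mul_domain.2 ⟨hfL, hfLL⟩) hfL
    refine ⟨h, hb.trans ?_, ?_⟩
    · gcongr
      linarith [le_abs_self c]
    · intro g g' g₁ g₂ hg hg₁ hg₂
      obtain ⟨hgW, rfl⟩ := UnboundedOp.mk_mem_graph_iff.1 hg
      obtain ⟨hgL, rfl⟩ := UnboundedOp.mk_mem_graph_iff.1 hg₁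
      obtain ⟨hgLL, rfl⟩ := UnboundedOp.mk_mem_graph_iff.1 hg₂
      exact key g hgW (UnboundedOp.mem_mul_domain.2 ⟨hgL, hgLL⟩)
  obtain ⟨hd, hd', T, hT⟩ := hcomm.dense_and_exists_clm (by positivity) hr
    (UnboundedOp.isSelfAdjointRelation_graph hL) (UnboundedOp.dense_setOf_mem_graph hL)
    (UnboundedOp.isSelfAdjointRelation_graph hW) (UnboundedOp.dense_setOf_mem_graph hW)
    (by
      intro f f' hf
      obtain ⟨hfL, rfl⟩ := UnboundedOp.mk_mem_graph_iff.1 hf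
      exact hL_nonneg ⟨f, hfL⟩)
    (by
      intro f hf
      obtain ⟨hfL, h0⟩ := UnboundedOp.mk_mem_graph_iff.1 hf
      exact congrArg Subtype.val (hL_null ⟨f, hfL⟩ h0))
    (by
      rintro f f₁ f₂ hf hf₁ ⟨k, hk⟩
      obtain ⟨hfL, rfl⟩ := UnboundedOp.mk_mem_graph_iff.1 hf
      obtain ⟨hfLL, rfl⟩ := UnboundedOp.mk_mem_graph_iff.1 hf₁
      obtain ⟨hkW, -⟩ := UnboundedOp.mk_mem_graph_iff.1 hk
      exact ⟨_, UnboundedOp.mk_mem_graph_iff.2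
        ⟨hdom ⟨f, UnboundedOp.mem_mul_domain.2 ⟨hfL, hfLL⟩⟩ hkW, rfl⟩⟩)
  have hweak : ∀ f : X, f ∈ W.domain → f ∈ L.domain → UnboundedOp.IsWeakCommutatorAt W L f (T f) :=
    fun f hfW hfL => ⟨hfW, hfL, fun g hgW hgL => hT _ _ _ _ _ _
      (UnboundedOp.mk_mem_graph_iff.2 ⟨hfW, rfl⟩) (UnboundedOp.mk_mem_graph_iff.2 ⟨hfL, rfl⟩)
      (UnboundedOp.mk_mem_graph_iff.2 ⟨hgW, rfl⟩) (UnboundedOp.mk_mem_graph_iff.2 ⟨hgL, rfl⟩)⟩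
  refine ⟨hd.mono ?_, T, ?_, hweak⟩
  · rintro f ⟨a, b, k, l, hfa, hab, hfk, hkl⟩
    obtain ⟨hfL, rfl⟩ := UnboundedOp.mk_mem_graph_iff.1 hfa
    obtain ⟨haW, -⟩ := UnboundedOp.mk_mem_graph_iff.1 hab
    obtain ⟨hfW, rfl⟩ := UnboundedOp.mk_mem_graph_iff.1 hfk
    obtain ⟨hkL, -⟩ := UnboundedOp.mk_mem_graph_iff.1 hkl
    exact ⟨UnboundedOp.mem_mul_domain.2 ⟨hfL, haW⟩, UnboundedOp.mem_mul_domain.2 ⟨hfW, hkL⟩⟩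
  · rintro ⟨f, hf⟩
    obtain ⟨hfL, haW⟩ := UnboundedOp.mem_mul_domain.1 hf.1
    obtain ⟨hfW, hkL⟩ := UnboundedOp.mem_mul_domain.1 hf.2
    -- The strong commutator and T f have equal inner products with the dense set D(W) ∩ D(L).
    refine hd'.eq_of_inner_right ℂ ?_
    rintro g ⟨⟨g', hg⟩, g₁, hg₁⟩
    obtain ⟨hgW, -⟩ := UnboundedOp.mk_mem_graph_iff.1 hg
    obtain ⟨hgL, -⟩ := UnboundedOp.mk_mem_graph_iff.1 hg₁
    obtain ⟨_, _, key⟩ := hweak f hfW hfL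
    rw [key g hgW hgL]
    change ⟪g, W ⟨L ⟨f, hfL⟩, haW⟩ - L ⟨W ⟨f, hfW⟩, hkL⟩⟫_ℂ = _
    rw [inner_sub_right,
      (UnboundedOp.isSelfAdjointRelation_graph hW).inner_eq
        (UnboundedOp.mk_mem_graph_iff.2 ⟨haW, rfl⟩) (UnboundedOp.mk_mem_graph_iff.2 ⟨hgW, rfl⟩),
      (UnboundedOp.isSelfAdjointRelation_graph hL).inner_eq
        (UnboundedOp.mk_mem_graph_iff.2 ⟨hkL, rfl⟩) (UnboundedOp.mk_mem_graph_iff.2 ⟨hgL, rfl⟩)]
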